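/- Let $k$ be an algebraically closed field of characteristic $0$ and let $H$ be a semisimple Hopf algebra over $k$ with comultiplication $\Delta$ and counit $\varepsilon$. Let $R=\sum R^1\otimes R^2\in H\otimes H$ be such that $(H,R)$ is factorizable, that is: (a) $(H,R)$ is quasitriangular: $R$ is a unit of $H\otimes H$, $\tau(\Delta(h))R=R\,\Delta(h)$ for all $h\in H$, where $\tau(a\otimes b)=b\otimes a$, and $$(\Delta\otimes\mathrm{id})(R)=R_{13}R_{23},\qquad (\mathrm{id}\otimes\Delta)(R)=R_{13}R_{12},$$ where $R_{12}=\sum R^1\otimes R^2\otimes 1$, $R_{13}=\sum R^1\otimes 1\otimes R^2$, $R_{23}=\sum 1\otimes R^1\otimes R^2$; (b) with $b=\tau(R)R=\sum b^1\otimes b^2$, the Drinfeld map $\Phi\colon H^*\to H$, $\Phi(f)=\sum b^1\langle f,b^2\rangle$, is bijective. Let $\mathscr R(H)$ be the representation ring of $H$: the abelian group generated by the isomorphism classes $[V]$ of finite-dimensional representations of $H$ with relations $[V\oplus W]=[V]+[W]$, and with multiplication $[V][W]=[V\otimes W]$. Put $\mathscr R_k(H)=\mathscr R(H)\otimes_{\mathbb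 Z}k$. Let $\chi_k\colon\mathscr R_k(H)\to H^*$ be the $k$-linear character map, $[V]\otimes 1\mapsto\chi_V$ with $\chi_V(h)=\operatorname{trace}(h_V)$, and let $\delta\colon\mathscr R_k(H)\to k$ be the linear form $[V]\otimes 1\mapsto(\dim_k V^H)1_k$, where $V^H=\{v\in V\mid hv=\varepsilon(h)v\ \text{for all } h\in H\}$. Let $\lambda=(\dim_k H)^{-1}\chi_{\mathrm{reg}}\in H^*$, where $\chi_{\mathrm{reg}}(h)$ is the trace of left multiplication by $h$ on $H$. A symmetric algebra is a pair $(A,\mu)$ consisting of a finite-dimensional $k$-algebra $A$ and a linear form $\mu\colon A\to k$ such that $\mu(ab)=\mu(ba)$ for all $a,b\in A$, and such that $\mu(ca)=0$ for all $c\in A$ implies $a=0$. An embedding of symmetric algebras $(A,\mu)\to(B,\nu)$ is an injective $k$-algebra map $f\colon A\to B$ with $\mu=\nu\circ f$. Then $(\mathscr R_k(H),\delta)$ and $(H,\lambda)$ are symmetric algebras, and $$\Psi=\Phi\circ\chi_k\colon(\mathscr R_k(H),\delta)\longrightarrow(H,\lambda)$$ is an embedding of symmetric algebras. Its image is the center of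 $H$. -/

import Mathlib

open scoped TensorProduct

universe u v w

noncomputable section

namespace HopfRep

/-! ### Symmetric algebras -/

section Symmetric

variable {k : Type u} [Field k] {A : Type v} [Ring A] [Algebra k A] {B : Type w} [Ring B]
  [Algebra k B]

/-- A Frobenius trace form on `A`: a linear form `lam` with `lam (a * b) = lam (b * a)` which is
nondegenerate, that is, `a ⇀ lam = 0` forces `a = 0`, where `(a ⇀ lam) c = lam (c * a)`. -/
structure IsFrobeniusTraceForm (lam : Module.Dual k A) : Prop where
  trace_form : ∀ a b : A, lam (a * b) = lam (b * a)
  nondegenerate : ∀ a : A, (∀ c : A, lam (c * a) = 0) → a = 0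

/-- `(A, lam)` is a symmetric algebra: `A` is a finite-dimensional algebra and `lam` is a
Frobenius trace form on it. -/
structure IsSymmetricPair (lam : Module.Dual k A) : Prop where
  finite : Module.Finite k A
  frobenius : IsFrobeniusTraceForm lam

/-- The algebra map `f : A → B` is an embedding of symmetric algebras `(A, lam) → (B, mu)`. -/
structure IsSymmetricEmbedding (lam : Module.Dual k A) (mu : Module.Dual k B)
    (f : A →ₐ[k] B) : Prop where
  source : IsSymmetricPair lam
  target : IsSymmetricPair mu
  form_comp : lam = mu ∘ₗ f.toLinearMap
  injective : Function.Injective f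

end Symmetric

/-! ### Finite-dimensional representations of a bialgebra -/

/-- A finite-dimensional representation of the `k`-algebra `H`. The carrier lives in the
universe of `k`; every finite-dimensional representation is isomorphic to one on some `kⁿ`, so no
isomorphism class is lost. -/
structure FinRep (k : Type u) [Field k] (H : Type v) [Ring H] [Algebra k H] where
  V : Type u
  [addCommGroup : AddCommGroup V]
  [module : Module k V]
  [finite : Module.Finite k V]
  ρ : H →ₐ[k] Module.End k V

attribute [instance] FinRep.addCommGroup FinRep.module FinRep.finite

namespace FinRep

section Algebra

variable {k : Type u} [Field k] {H : Type v} [Ring H] [Algebra k H]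

/-- Isomorphism of representations: there is an `H`-equivariant linear isomorphism. -/
def Iso (X Y : FinRep k H) : Prop :=
  ∃ e : X.V ≃ₗ[k] Y.V, ∀ (h : H) (x : X.V), e (X.ρ h x) = Y.ρ h (e x)

instance isoSetoid (k : Type u) [Field k] (H : Type v) [Ring H] [Algebra k H] :
    Setoid (FinRep k H) where
  r := Iso
  iseqv :=
    { refl := fun X => ⟨LinearEquiv.refl k X.V, fun _ _ => rfl⟩
      symm := by
        rintro X Y ⟨e, he⟩
        refine ⟨e.symm, fun h y => ?_⟩
        rw [LinearEquiv.symm_apply_eq, he, LinearEquiv.apply_symm_apply]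
      trans := by
        rintro X Y Z ⟨e, he⟩ ⟨f, hf⟩
        exact ⟨e.trans f, fun h x => by simp [he, hf]⟩ }

/-- The direct sum `X ⊕ Y`, with `h (x, y) = (h x, h y)`. -/
def directSum (X Y : FinRep k H) : FinRep k H where
  V := X.V × Y.V
  ρ := (LinearMap.prodMapAlgHom k X.V Y.V).comp (X.ρ.prod Y.ρ)

@[simp] theorem directSum_ρ (X Y : FinRep k H) (h : H) (x : X.V) (y : Y.V) :
    (X.directSum Y).ρ h (x, y) = (X.ρ h x, Y.ρ h y) := rfl

/-- The character `h ↦ trace (h_V)`. -/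
def character (X : FinRep k H) : Module.Dual k H :=
  LinearMap.trace k X.V ∘ₗ X.ρ.toLinearMap

theorem character_iso {X Y : FinRep k H} (h : Iso X Y) : X.character = Y.character := by
  obtain ⟨e, he⟩ := h
  ext a
  have : Y.ρ a = e.conj (X.ρ a) := by
    ext y
    simp [LinearEquiv.conj_apply, he]
  simp only [character, LinearMap.comp_apply, AlgHom.toLinearMap_apply]
  rw [this, LinearMap.trace_conj']

theorem character_directSum (X Y : FinRep k H) :
    (X.directSum Y).character = X.character + Y.character := by
  ext a
  exact LinearMap.trace_prodMap' (X.ρ a) (Y.ρ a)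

end Algebra

section Bialgebra

variable {k : Type u} [Field k] {H : Type v} [Ring H] [Bialgebra k H]

/-- The action of `H ⊗ H` on `X ⊗ Y`. -/
def act₂ (X Y : FinRep k H) : H ⊗[k] H →ₐ[k] Module.End k (X.V ⊗[k] Y.V) :=
  (Module.endTensorEndAlgHom (R := k) (S := k) (A := k) (M := X.V) (N := Y.V)).comp
    (Algebra.TensorProduct.map X.ρ Y.ρ)

@[simp] theorem act₂_tmul (X Y : FinRep k H) (a b : H) (x : X.V) (y : Y.V) :
    act₂ X Y (a ⊗ₜ b) (x ⊗ₜ y) = X.ρ a x ⊗ₜ Y.ρ b y := rfl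

/-- The tensor product `X ⊗ Y`, on which `h` acts by `Δ(h) = h₁ ⊗ h₂`. -/
def tensor (X Y : FinRep k H) : FinRep k H where
  V := X.V ⊗[k] Y.V
  ρ := (act₂ X Y).comp (Bialgebra.comulAlgHom k H)

theorem tensor_ρ (X Y : FinRep k H) (h : H) :
    (X.tensor Y).ρ h = act₂ X Y (Coalgebra.comul (R := k) h) := rfl

/-- The trivial representation, on which `h` acts by `ε(h)`. -/
def trivial (k : Type u) [Field k] (H : Type v) [Ring H] [Bialgebra k H] : FinRep k H where
  V := k
  ρ := (Algebra.ofId k (Module.End k k)).comp (Bialgebra.counitAlgHom k H)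

/-- The space of invariants `V^H = {x | h x = ε(h) x for all h}`. -/
def invariants (X : FinRep k H) : Submodule k X.V where
  carrier := {x | ∀ h : H, X.ρ h x = Coalgebra.counit (R := k) h • x}
  zero_mem' := by simp
  add_mem' := by
    intro x y hx hy h
    rw [map_add, hx h, hy h, smul_add]
  smul_mem' := by
    intro c x hx h
    rw [map_smul, hx h, smul_comm]

theorem finrank_invariants_iso {X Y : FinRep k H} (h : Iso X Y) :
    Module.finrank k X.invariants = Module.finrank k Y.invariants := by
  obtain ⟨e, he⟩ := h
  have : Y.invariants = X.invariants.map (e : X.V →ₗ[k] Y.V) := by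
    ext y
    constructor
    · intro hy
      refine ⟨e.symm y, fun a => e.injective ?_, by simp⟩
      rw [he, map_smul, e.apply_symm_apply, hy a]
    · rintro ⟨x, hx, rfl⟩ a
      have := hx a
      simp only [LinearEquiv.coe_coe]
      rw [← he, this, map_smul]
  rw [this]
  exact (LinearEquiv.finrank_map_eq e X.invariants).symm

theorem finrank_invariants_directSum (X Y : FinRep k H) :
    Module.finrank k (X.directSum Y).invariants =
      Module.finrank k X.invariants + Module.finrank k Y.invariants := by
  have h : ∀ z : (X.directSum Y).V, z ∈ (X.directSum Y).invariants ↔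
      z.1 ∈ X.invariants ∧ z.2 ∈ Y.invariants := fun z =>
    ⟨fun h => ⟨fun a => congrArg Prod.fst (h a), fun a => congrArg Prod.snd (h a)⟩,
      fun h a => Prod.ext (h.1 a) (h.2 a)⟩
  let e : (X.directSum Y).invariants ≃ₗ[k] X.invariants × Y.invariants :=
    { toFun := fun z => (⟨z.1.1, ((h z.1).1 z.2).1⟩, ⟨z.1.2, ((h z.1).1 z.2).2⟩)
      invFun := fun z => ⟨(z.1.1, z.2.1), (h (z.1.1, z.2.1)).2 ⟨z.1.2, z.2.2⟩⟩
      map_add' := fun _ _ => rfl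
      map_smul' := fun _ _ => rfl
      left_inv := fun _ => rfl
      right_inv := fun _ => rfl }
  rw [e.finrank_eq, Module.finrank_prod]

theorem trivial_ρ (h : H) (c : k) :
    (trivial k H).ρ h c = Coalgebra.counit (R := k) h * c := rfl

/-! Compatibility of `⊗` and `⊕` with isomorphism, and the monoid laws up to isomorphism. -/

/-- A criterion for a linear isomorphism `X ⊗ Y → W` to be equivariant. -/
theorem tensor_iso_of_act (X Y W : FinRep k H) (e : X.V ⊗[k] Y.V ≃ₗ[k] W.V)
    (A : H ⊗[k] H →ₗ[k] Module.End k W.V)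
    (hA : ∀ h, W.ρ h = A (Coalgebra.comul (R := k) h))
    (he : ∀ a b x y, e (X.ρ a x ⊗ₜ Y.ρ b y) = A (a ⊗ₜ b) (e (x ⊗ₜ y))) :
    Iso (X.tensor Y) W := by
  have key : ∀ t : H ⊗[k] H, e.toLinearMap ∘ₗ act₂ X Y t = A t ∘ₗ e.toLinearMap := by
    intro t
    induction t with
    | zero => simp
    | add s t hs ht => rw [map_add, map_add, LinearMap.comp_add, LinearMap.add_comp, hs, ht]
    | tmul a b => exact TensorProduct.ext' fun x y => he a b x y
  refine ⟨e, fun h z => ?_⟩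
  rw [hA]
  exact LinearMap.congr_fun (key _) z

theorem tensor_iso {X X' Y Y' : FinRep k H} (hX : Iso X X') (hY : Iso Y Y') :
    Iso (X.tensor Y) (X'.tensor Y') := by
  obtain ⟨e, he⟩ := hX
  obtain ⟨f, hf⟩ := hY
  refine tensor_iso_of_act X Y (X'.tensor Y') (TensorProduct.congr e f)
    (act₂ X' Y').toLinearMap (fun h => rfl) fun a b x y => ?_
  change e (X.ρ a x) ⊗ₜ f (Y.ρ b y) = X'.ρ a (e x) ⊗ₜ[k] Y'.ρ b (f y)
  rw [he, hf]

theorem tensor_assoc_iso (X Y Z : FinRep k H) :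
    Iso ((X.tensor Y).tensor Z) (X.tensor (Y.tensor Z)) := by
  let A : H ⊗[k] (H ⊗[k] H) →ₗ[k] Module.End k (X.V ⊗[k] (Y.V ⊗[k] Z.V)) :=
    (Module.endTensorEndAlgHom (R := k) (S := k) (A := k)).toLinearMap ∘ₗ
      TensorProduct.map X.ρ.toLinearMap (act₂ Y Z).toLinearMap
  have h₁ : ∀ t : H ⊗[k] H, act₂ X (Y.tensor Z) t =
      A ((Coalgebra.comul (R := k) (A := H)).lTensor H t) := by
    intro t
    induction t with
    | zero => rw [map_zero, map_zero, map_zero]; rfl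
    | add s t hs ht => rw [map_add, map_add, map_add, hs, ht]; rfl
    | tmul a b => rfl
  have h₂ : ∀ (s : H ⊗[k] H) (b : H) (z : (X.V ⊗[k] Y.V) ⊗[k] Z.V),
      TensorProduct.assoc k X.V Y.V Z.V (TensorProduct.map (act₂ X Y s) (Z.ρ b) z) =
        A (TensorProduct.assoc k H H H (s ⊗ₜ b)) (TensorProduct.assoc k X.V Y.V Z.V z) := by
    intro s b z
    induction s with
    | zero => simp
    | add s t hs ht =>
      simp only [map_add, TensorProduct.add_tmul, TensorProduct.map_add_left,
        LinearMap.add_apply, hs, ht]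
    | tmul a c =>
      have : (TensorProduct.assoc k X.V Y.V Z.V).toLinearMap ∘ₗ
          TensorProduct.map (act₂ X Y (a ⊗ₜ c)) (Z.ρ b) =
          A (a ⊗ₜ (c ⊗ₜ b)) ∘ₗ (TensorProduct.assoc k X.V Y.V Z.V).toLinearMap := by
        refine TensorProduct.ext_threefold fun x y z => ?_
        rfl
      exact LinearMap.congr_fun this z
  have h₃ : ∀ (t : H ⊗[k] H) (z : (X.V ⊗[k] Y.V) ⊗[k] Z.V),
      TensorProduct.assoc k X.V Y.V Z.V (act₂ (X.tensor Y) Z t z) =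
        A (TensorProduct.assoc k H H H ((Coalgebra.comul (R := k) (A := H)).rTensor H t))
          (TensorProduct.assoc k X.V Y.V Z.V z) := by
    intro t z
    induction t with
    | zero =>
      rw [map_zero, map_zero, map_zero, map_zero, LinearMap.zero_apply]
      exact map_zero (TensorProduct.assoc k X.V Y.V Z.V)
    | add s t hs ht =>
      rw [map_add, map_add, map_add, map_add, LinearMap.add_apply, ← hs, ← ht]
      exact map_add (TensorProduct.assoc k X.V Y.V Z.V) _ _
    | tmul a b => exact h₂ _ b z
  refine ⟨TensorProduct.assoc k X.V Y.V Z.V, fun h z => ?_⟩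
  have h₄ := h₃ (Coalgebra.comul (R := k) h) z
  rw [Coalgebra.coassoc_apply, ← h₁] at h₄
  exact h₄

theorem one_tensor_iso (X : FinRep k H) : Iso ((trivial k H).tensor X) X := by
  refine tensor_iso_of_act (trivial k H) X X (TensorProduct.lid k X.V)
    (X.ρ.toLinearMap ∘ₗ (TensorProduct.lid k H).toLinearMap ∘ₗ
      (Coalgebra.counit (R := k) (A := H)).rTensor H) (fun h => ?_) fun a b (c : k) x => ?_
  · simp
  · change (Coalgebra.counit (R := k) a * c) • X.ρ b x =
      X.ρ (Coalgebra.counit (R := k) a • b) (c • x)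
    rw [mul_smul, map_smul, map_smul, LinearMap.smul_apply, smul_comm]

theorem tensor_one_iso (X : FinRep k H) : Iso (X.tensor (trivial k H)) X := by
  refine tensor_iso_of_act X (trivial k H) X (TensorProduct.rid k X.V)
    (X.ρ.toLinearMap ∘ₗ (TensorProduct.rid k H).toLinearMap ∘ₗ
      (Coalgebra.counit (R := k) (A := H)).lTensor H) (fun h => ?_) fun a b x (c : k) => ?_
  · simp
  · change (Coalgebra.counit (R := k) b * c) • X.ρ a x =
      X.ρ (Coalgebra.counit (R := k) b • a) (c • x)
    rw [mul_smul, map_smul, map_smul, LinearMap.smul_apply, smul_comm]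

theorem directSum_iso {X X' Y Y' : FinRep k H} (hX : Iso X X') (hY : Iso Y Y') :
    Iso (X.directSum Y) (X'.directSum Y') := by
  obtain ⟨e, he⟩ := hX
  obtain ⟨f, hf⟩ := hY
  exact ⟨LinearEquiv.prodCongr e f, fun h z => Prod.ext (he h z.1) (hf h z.2)⟩

theorem tensor_directSum_iso (X Y Z : FinRep k H) :
    Iso (X.tensor (Y.directSum Z)) ((X.tensor Y).directSum (X.tensor Z)) :=
  tensor_iso_of_act X (Y.directSum Z) ((X.tensor Y).directSum (X.tensor Z))
    (TensorProduct.prodRight k k X.V Y.V Z.V)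
    ((LinearMap.prodMapAlgHom k (X.V ⊗[k] Y.V) (X.V ⊗[k] Z.V)).comp
      ((act₂ X Y).prod (act₂ X Z))).toLinearMap (fun _ => rfl) fun _ _ _ _ => rfl

theorem directSum_tensor_iso (X Y Z : FinRep k H) :
    Iso ((X.directSum Y).tensor Z) ((X.tensor Z).directSum (Y.tensor Z)) :=
  tensor_iso_of_act (X.directSum Y) Z ((X.tensor Z).directSum (Y.tensor Z))
    (TensorProduct.prodLeft k k X.V Y.V Z.V)
    ((LinearMap.prodMapAlgHom k (X.V ⊗[k] Z.V) (Y.V ⊗[k] Z.V)).comp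
      ((act₂ X Z).prod (act₂ Y Z))).toLinearMap (fun _ => rfl) fun _ _ _ _ => rfl

end Bialgebra

end FinRep

/-! ### The representation ring -/

section RepresentationRing

variable (k : Type u) [Field k] (H : Type v) [Ring H] [Bialgebra k H]

/-- The isomorphism classes of finite-dimensional representations of `H`. -/
def IsoClass : Type (max (u + 1) v) := Quotient (FinRep.isoSetoid k H)

/-- Isomorphism classes form a monoid under the tensor product. -/
instance : Monoid (IsoClass k H) where
  mul := Quotient.map₂ FinRep.tensor fun _ _ hX _ _ hY => FinRep.tensor_iso hX hY
  one := Quotient.mk _ (FinRep.trivial k H)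
  mul_assoc := by
    rintro ⟨X⟩ ⟨Y⟩ ⟨Z⟩
    exact Quotient.sound (FinRep.tensor_assoc_iso X Y Z)
  one_mul := by
    rintro ⟨X⟩
    exact Quotient.sound (FinRep.one_tensor_iso X)
  mul_one := by
    rintro ⟨X⟩
    exact Quotient.sound (FinRep.tensor_one_iso X)

variable {k H} in
/-- The isomorphism class of a representation. -/
def isoClass (X : FinRep k H) : IsoClass k H := Quotient.mk _ X

/-- The relations `[X ⊕ Y] - [X] - [Y]` in the free abelian group on isomorphism classes; the
multiplication of this free abelian group is the one with `[X] [Y] = [X ⊗ Y]`. -/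
def directSumRelations : AddSubgroup (FreeAbelianGroup (IsoClass k H)) :=
  AddSubgroup.closure (Set.range fun p : FinRep k H × FinRep k H =>
    FreeAbelianGroup.of (isoClass (p.1.directSum p.2)) - FreeAbelianGroup.of (isoClass p.1) -
      FreeAbelianGroup.of (isoClass p.2))

variable {k H} in
theorem relation_mem (X Y : FinRep k H) :
    FreeAbelianGroup.of (isoClass (X.directSum Y)) - FreeAbelianGroup.of (isoClass X) -
      FreeAbelianGroup.of (isoClass Y) ∈ directSumRelations k H :=
  AddSubgroup.subset_closure ⟨(X, Y), rfl⟩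

variable {k H} in
theorem mul_mem_relations_left (a : FreeAbelianGroup (IsoClass k H))
    {b : FreeAbelianGroup (IsoClass k H)} (hb : b ∈ directSumRelations k H) :
    a * b ∈ directSumRelations k H := by
  induction hb using AddSubgroup.closure_induction with
  | zero => rw [mul_zero]; exact zero_mem _
  | add x y _ _ hx hy => rw [mul_add]; exact add_mem hx hy
  | neg x _ hx => rw [mul_neg]; exact neg_mem hx
  | mem x hx =>
    obtain ⟨⟨Y, Z⟩, rfl⟩ := hx
    induction a using FreeAbelianGroup.induction_on with
    | zero => rw [zero_mul]; exact zero_mem _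
    | add x y hx hy => rw [add_mul]; exact add_mem hx hy
    | neg x hx => rw [neg_mul]; exact neg_mem hx
    | of x =>
      induction x using Quotient.inductionOn with
      | h X =>
        have h : isoClass X * isoClass (Y.directSum Z) =
            isoClass ((X.tensor Y).directSum (X.tensor Z)) :=
          Quotient.sound (FinRep.tensor_directSum_iso X Y Z)
        change FreeAbelianGroup.of (isoClass X) * _ ∈ _
        simp only [mul_sub, FreeAbelianGroup.of_mul_of]
        rw [h]
        exact relation_mem (X.tensor Y) (X.tensor Z)

variable {k H} in
theorem mul_mem_relations_right {a : FreeAbelianGroup (IsoClass k H)}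
    (b : FreeAbelianGroup (IsoClass k H)) (ha : a ∈ directSumRelations k H) :
    a * b ∈ directSumRelations k H := by
  induction ha using AddSubgroup.closure_induction with
  | zero => rw [zero_mul]; exact zero_mem _
  | add x y _ _ hx hy => rw [add_mul]; exact add_mem hx hy
  | neg x _ hx => rw [neg_mul]; exact neg_mem hx
  | mem x hx =>
    obtain ⟨⟨X, Y⟩, rfl⟩ := hx
    induction b using FreeAbelianGroup.induction_on with
    | zero => rw [mul_zero]; exact zero_mem _
    | add x y hx hy => rw [mul_add]; exact add_mem hx hy
    | neg x hx => rw [mul_neg]; exact neg_mem hx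
    | of x =>
      induction x using Quotient.inductionOn with
      | h Z =>
        have h : isoClass (X.directSum Y) * isoClass Z =
            isoClass ((X.tensor Z).directSum (Y.tensor Z)) :=
          Quotient.sound (FinRep.directSum_tensor_iso X Y Z)
        change _ * FreeAbelianGroup.of (isoClass Z) ∈ _
        simp only [sub_mul, FreeAbelianGroup.of_mul_of]
        rw [h]
        exact relation_mem (X.tensor Z) (Y.tensor Z)

/-- The subgroup of relations is a two-sided ideal. -/
def directSumIdeal : TwoSidedIdeal (FreeAbelianGroup (IsoClass k H)) :=
  TwoSidedIdeal.mk' (directSumRelations k H) (zero_mem _) (fun hx hy => add_mem hx hy)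
    (fun hx => neg_mem hx) (fun hy => mul_mem_relations_left _ hy)
    (fun hx => mul_mem_relations_right _ hx)

/-- The representation ring `R(H)`: the abelian group generated by the isomorphism classes `[X]`
with relations `[X ⊕ Y] = [X] + [Y]`, with multiplication `[X] [Y] = [X ⊗ Y]`. -/
abbrev RepRing : Type (max (u + 1) v) := (directSumIdeal k H).ringCon.Quotient

variable {k H} in
/-- The class `[X]` in the representation ring. -/
def RepRing.of (X : FinRep k H) : RepRing k H :=
  (directSumIdeal k H).ringCon.mk' (FreeAbelianGroup.of (isoClass X))

variable {k H} in
/-- An isomorphism invariant function on representations, as a function on isomorphism classes. -/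
def RepRing.liftAux {G : Type w} (f : FinRep k H → G)
    (hf : ∀ X Y, FinRep.Iso X Y → f X = f Y) : IsoClass k H → G :=
  Quotient.lift f hf

variable {k H} in
/-- A function on representations that is invariant under isomorphism and additive on direct
sums extends to the representation ring. -/
def RepRing.lift {G : Type w} [AddCommGroup G] (f : FinRep k H → G)
    (hf : ∀ X Y, FinRep.Iso X Y → f X = f Y)
    (hadd : ∀ X Y, f (X.directSum Y) = f X + f Y) : RepRing k H →+ G where
  toFun := Quotient.lift (FreeAbelianGroup.lift (RepRing.liftAux f hf)) fun a b hab => by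
    have hle : directSumRelations k H ≤
        (FreeAbelianGroup.lift (RepRing.liftAux f hf) :
          FreeAbelianGroup (IsoClass k H) →+ G).ker := by
      refine (AddSubgroup.closure_le _).2 ?_
      rintro _ ⟨⟨X, Y⟩, rfl⟩
      simp only [SetLike.mem_coe, AddMonoidHom.mem_ker, map_sub, FreeAbelianGroup.lift_apply_of]
      change f (X.directSum Y) - f X - f Y = 0
      rw [hadd]
      abel
    have := hle (show a - b ∈ directSumRelations k H from hab)
    rwa [AddMonoidHom.mem_ker, map_sub, sub_eq_zero] at this
  map_zero' := map_zero (FreeAbelianGroup.lift (RepRing.liftAux f hf))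
  map_add' := by
    rintro ⟨a⟩ ⟨b⟩
    exact map_add (FreeAbelianGroup.lift (RepRing.liftAux f hf)) a b

/-- The representation algebra `R_k(H)`, the extension of scalars of `R(H)` from `ℤ` to `k`. -/
abbrev RepAlgebra : Type (max (u + 1) v) := k ⊗[ℤ] RepRing k H

/-- The character map `R_k(H) → H^*`, with `1 ⊗ [X] ↦ χ_X`. -/
def characterMap : RepAlgebra k H →ₗ[k] Module.Dual k H :=
  LinearMap.liftBaseChange k (RepRing.lift FinRep.character
    (fun _ _ => FinRep.character_iso) FinRep.character_directSum).toIntLinearMap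

/-- The linear form `δ` on `R_k(H)`, with `1 ⊗ [X] ↦ dim X^H`. -/
def invariantsForm : Module.Dual k (RepAlgebra k H) :=
  LinearMap.liftBaseChange k (RepRing.lift
    (fun X : FinRep k H => (Module.finrank k X.invariants : k))
    (fun _ _ h => by rw [FinRep.finrank_invariants_iso h])
    (fun X Y => by rw [FinRep.finrank_invariants_directSum, Nat.cast_add])).toIntLinearMap

end RepresentationRing

/-- The normalized regular character `λ = (dim H)⁻¹ χ_reg`, where `χ_reg(h)` is the trace of left
multiplication by `h` on `H`. -/
def normalizedRegularCharacter (k : Type u) [Field k] (H : Type v) [Ring H] [Algebra k H] :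
    Module.Dual k H :=
  (Module.finrank k H : k)⁻¹ • (LinearMap.trace k H ∘ₗ LinearMap.mul k H)

/-! ### Factorizable Hopf algebras -/

section Factorizable

variable {k : Type u} [Field k] {H : Type v} [Ring H] [HopfAlgebra k H]

/-- The switch map `a ⊗ b ↦ b ⊗ a`. -/
def switch : H ⊗[k] H →ₐ[k] H ⊗[k] H := (Algebra.TensorProduct.comm k H H).toAlgHom

/-- `R ↦ R₁₂ = R¹ ⊗ R² ⊗ 1`. -/
def leg₁₂ : H ⊗[k] H →ₐ[k] H ⊗[k] (H ⊗[k] H) :=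
  Algebra.TensorProduct.map (AlgHom.id k H) Algebra.TensorProduct.includeLeft

/-- `R ↦ R₁₃ = R¹ ⊗ 1 ⊗ R²`. -/
def leg₁₃ : H ⊗[k] H →ₐ[k] H ⊗[k] (H ⊗[k] H) :=
  Algebra.TensorProduct.map (AlgHom.id k H) Algebra.TensorProduct.includeRight

/-- `R ↦ R₂₃ = 1 ⊗ R¹ ⊗ R²`. -/
def leg₂₃ : H ⊗[k] H →ₐ[k] H ⊗[k] (H ⊗[k] H) :=
  Algebra.TensorProduct.includeRight

/-- `(H, R)` is quasitriangular: `R` is a unit with `τ(Δ(h)) R = R Δ(h)`,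
`(Δ ⊗ id)(R) = R₁₃ R₂₃` and `(id ⊗ Δ)(R) = R₁₃ R₁₂`. -/
structure IsQuasitriangular (R : H ⊗[k] H) : Prop where
  isUnit : IsUnit R
  almost_cocommutative : ∀ h : H,
    switch (Coalgebra.comul (R := k) h) * R = R * Coalgebra.comul (R := k) h
  comul_left : TensorProduct.assoc k H H H ((Coalgebra.comul (R := k) (A := H)).rTensor H R) =
    leg₁₃ R * leg₂₃ R
  comul_right : (Coalgebra.comul (R := k) (A := H)).lTensor H R = leg₁₃ R * leg₁₂ R

/-- The Drinfeld map `Φ : H^* → H`, `Φ(f) = b¹ f(b²)` where `b = τ(R) R`. -/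
def drinfeldMap (R : H ⊗[k] H) : Module.Dual k H →ₗ[k] H where
  toFun f := TensorProduct.rid k H (f.lTensor H (switch R * R))
  map_add' f g := by rw [LinearMap.lTensor_add, LinearMap.add_apply, map_add]
  map_smul' c f := by rw [LinearMap.lTensor_smul, LinearMap.smul_apply, map_smul, RingHom.id_apply]

/-- `(H, R)` is factorizable: it is quasitriangular and the Drinfeld map is bijective. -/
structure IsFactorizable (R : H ⊗[k] H) : Prop where
  quasitriangular : IsQuasitriangular R
  bijective : Function.Bijective (drinfeldMap R)

end Factorizable

end HopfRep

end

/-! Everything rests on a pair of integrals. Semisimplicity gives a two-sided integral Λ of H with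
ε(Λ) = 1, and factorizability moves it to the dual: put lam = Φ⁻¹(Λ). Since Φ(f * g) = Φ(g)Φ(f) when
Φ(g) is central, and ε(Φ(f)) = f(1), one gets Φ(f * lam) = ΛΦ(f) = f(1)Λ, hence f * lam = f(1) lam.
So lam is an integral of the dual with lam(1) = 1 (`IsFactorizable.exists_integralPair`).

Such a pair makes lam nondegenerate, with S(Λ₁), Λ₂ as dual bases up to the scalar lam(Λ) ≠ 0 and
with Nakayama automorphism S². This gives S⁴ = 1 and trace formulas that force S² = 1, the
Larson–Radford theorem (`IsIntegralPair.antipode_sq`). Then lam is a trace form, and it equals the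
normalized regular character.

Because S² = 1, the map Φ sends class functions into the center, and there it is multiplicative.
Conversely z ↦ lam(z ·) embeds the center in the class functions, so by dimension Φ maps the class
functions onto the center. By Wedderburn, the character map identifies R_k(H) with the class
functions under convolution; hence Ψ is an isomorphism onto the center.

The forms correspond because δ[X] = χ_X(Λ) = χ_X(Φ(lam)) = lam(Φ(χ_X)), the last step by cyclicity
of traces. Nondegeneracy of δ is that of lam on the center, obtained by averaging y ↦ S(Λ₁)yΛ₂. -/

noncomputable section

namespace HopfRep

open Coalgebra HopfAlgebra TensorProduct

/-! ### Contracting the second tensor leg with a linear form -/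

section Slices

variable {k : Type u} [Field k] {H : Type v} [Ring H] [Algebra k H]

/-- The slice map `a ⊗ b ↦ f(b) a`. -/
def sliceRight (f : Module.Dual k H) : H ⊗[k] H →ₗ[k] H :=
  (TensorProduct.rid k H).toLinearMap ∘ₗ f.lTensor H

@[simp] theorem sliceRight_tmul (f : Module.Dual k H) (a b : H) :
    sliceRight f (a ⊗ₜ b) = f b • a := by
  simp [sliceRight]

theorem sliceRight_tmul_one_mul (f : Module.Dual k H) (a : H) (x : H ⊗[k] H) :
    sliceRight f ((a ⊗ₜ 1) * x) = a * sliceRight f x := by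
  induction x with
  | zero => simp
  | add x y hx hy => simp [mul_add, hx, hy]
  | tmul p q => simp

theorem sliceRight_mul_tmul_one (f : Module.Dual k H) (a : H) (x : H ⊗[k] H) :
    sliceRight f (x * (a ⊗ₜ 1)) = sliceRight f x * a := by
  induction x with
  | zero => simp
  | add x y hx hy => simp [add_mul, hx, hy]
  | tmul p q => simp

theorem sliceRight_one_tmul_mul (f : Module.Dual k H) (a : H) (x : H ⊗[k] H) :
    sliceRight f ((1 ⊗ₜ a) * x) = sliceRight (f ∘ₗ LinearMap.mulLeft k a) x := by
  induction x with
  | zero => simp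
  | add x y hx hy => simp [mul_add, hx, hy]
  | tmul p q => simp

theorem sliceRight_mul_one_tmul (f : Module.Dual k H) (a : H) (x : H ⊗[k] H) :
    sliceRight f (x * (1 ⊗ₜ a)) = sliceRight (f ∘ₗ LinearMap.mulRight k a) x := by
  induction x with
  | zero => simp
  | add x y hx hy => simp [add_mul, hx, hy]
  | tmul p q => simp

theorem sliceRight_mul_comm_of_trace {f : Module.Dual k H} (hf : ∀ a b, f (a * b) = f (b * a))
    (a : H) (x : H ⊗[k] H) :
    sliceRight f (x * (1 ⊗ₜ a)) = sliceRight f ((1 ⊗ₜ a) * x) := by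
  rw [sliceRight_mul_one_tmul, sliceRight_one_tmul_mul]
  have : f ∘ₗ LinearMap.mulRight k a = f ∘ₗ LinearMap.mulLeft k a := by
    ext b
    exact hf b a
  rw [this]

end Slices

/-! ### Sweedler identities for the antipode -/

section Antipode

variable {k : Type u} [Field k] {H : Type v} [Ring H] [HopfAlgebra k H]

/-- The working form of coassociativity: each choice of `T` turns it into one of the antipode
identities below. -/
theorem lTensor_comul_comul (h : H) {M : Type w} [AddCommGroup M] [Module k M]
    (T : H ⊗[k] (H ⊗[k] H) →ₗ[k] M) {ι : Type*} (r : Repr k h ι) :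
    ∑ i ∈ r.index, T (r.left i ⊗ₜ comul (R := k) (r.right i)) =
      ∑ i ∈ r.index, T (TensorProduct.assoc k H H H (comul (R := k) (r.left i) ⊗ₜ r.right i)) := by
  have h₁ := congrArg T (coassoc_apply (R := k) h)
  rw [← r.eq] at h₁
  simpa using h₁.symm

theorem sum_tmul_one_mul_antipode_comul {h : H} {ι : Type*} (r : Repr k h ι) :
    ∑ i ∈ r.index, (r.left i ⊗ₜ[k] (1 : H)) *
      (antipode k).rTensor H (comul (R := k) (r.right i)) = 1 ⊗ₜ h := by
  let m : H ⊗[k] H →ₗ[k] H := LinearMap.mul' k H ∘ₗ (antipode k).lTensor H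
  let T : H ⊗[k] (H ⊗[k] H) →ₗ[k] H ⊗[k] H :=
    m.rTensor H ∘ₗ (TensorProduct.assoc k H H H).symm.toLinearMap
  have hT : ∀ (a : H) (y : H ⊗[k] H), T (a ⊗ₜ y) = (a ⊗ₜ 1) * (antipode k).rTensor H y := by
    intro a y
    induction y with
    | zero => simp
    | add x y hx hy => rw [tmul_add, map_add, hx, hy, map_add, mul_add]
    | tmul p q => simp [T, m]
  simp_rw [← hT]
  rw [lTensor_comul_comul h T r]
  simp only [T, m, LinearMap.comp_apply, LinearEquiv.coe_coe, LinearEquiv.symm_apply_apply,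
    LinearMap.rTensor_tmul, mul_antipode_lTensor_comul_apply, Algebra.algebraMap_eq_smul_one,
    smul_tmul, ← tmul_sum, sum_counit_smul]

theorem sum_antipode_tmul_one_mul_comul {h : H} {ι : Type*} (r : Repr k h ι) :
    ∑ i ∈ r.index, (antipode k (r.left i) ⊗ₜ[k] (1 : H)) * comul (R := k) (r.right i) =
      1 ⊗ₜ h := by
  let m : H ⊗[k] H →ₗ[k] H := LinearMap.mul' k H ∘ₗ (antipode k).rTensor H
  let T : H ⊗[k] (H ⊗[k] H) →ₗ[k] H ⊗[k] H :=
    m.rTensor H ∘ₗ (TensorProduct.assoc k H H H).symm.toLinearMap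
  have hT : ∀ (a : H) (y : H ⊗[k] H), T (a ⊗ₜ y) = (antipode k a ⊗ₜ 1) * y := by
    intro a y
    induction y with
    | zero => simp
    | add x y hx hy => rw [tmul_add, map_add, hx, hy, mul_add]
    | tmul p q => simp [T, m]
  simp_rw [← hT]
  rw [lTensor_comul_comul h T r]
  simp only [T, m, LinearMap.comp_apply, LinearEquiv.coe_coe, LinearEquiv.symm_apply_apply,
    LinearMap.rTensor_tmul, mul_antipode_rTensor_comul_apply, Algebra.algebraMap_eq_smul_one,
    smul_tmul, ← tmul_sum, sum_counit_smul]

theorem sum_smul_counit {h : H} {ι : Type*} (r : Repr k h ι) :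
    ∑ i ∈ r.index, counit (R := k) (r.right i) • r.left i = h := by
  have := congrArg (TensorProduct.rid k H) (lTensor_counit_comul (R := k) h)
  rw [← r.eq] at this
  simpa only [map_sum, LinearMap.lTensor_tmul, TensorProduct.rid_tmul, one_smul] using this

theorem sum_comul_mul_one_tmul_antipode {h : H} {ι : Type*} (r : Repr k h ι) :
    ∑ i ∈ r.index, comul (R := k) (r.left i) * ((1 : H) ⊗ₜ[k] antipode k (r.right i)) =
      h ⊗ₜ 1 := by
  let m : H ⊗[k] H →ₗ[k] H := LinearMap.mul' k H ∘ₗ (antipode k).lTensor H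
  let T : H ⊗[k] (H ⊗[k] H) →ₗ[k] H ⊗[k] H := m.lTensor H
  have hT : ∀ (a : H) (y : H ⊗[k] H),
      T (TensorProduct.assoc k H H H (y ⊗ₜ a)) = y * (1 ⊗ₜ antipode k a) := by
    intro a y
    induction y with
    | zero => simp
    | add x y hx hy => rw [add_tmul, map_add, map_add, hx, hy, add_mul]
    | tmul p q => simp [T, m]
  simp_rw [← hT]
  rw [← lTensor_comul_comul h T r]
  simp only [T, m, LinearMap.comp_apply,
    LinearMap.lTensor_tmul, mul_antipode_lTensor_comul_apply, Algebra.algebraMap_eq_smul_one,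
    tmul_smul]
  simp only [smul_tmul', ← sum_tmul, sum_smul_counit]

theorem sum_antipode_comul_mul_one_tmul {h : H} {ι : Type*} (r : Repr k h ι) :
    ∑ i ∈ r.index, (antipode k).lTensor H (comul (R := k) (r.left i)) *
      ((1 : H) ⊗ₜ[k] r.right i) = h ⊗ₜ 1 := by
  let m : H ⊗[k] H →ₗ[k] H := LinearMap.mul' k H ∘ₗ (antipode k).rTensor H
  let T : H ⊗[k] (H ⊗[k] H) →ₗ[k] H ⊗[k] H := m.lTensor H
  have hT : ∀ (a : H) (y : H ⊗[k] H),
      T (TensorProduct.assoc k H H H (y ⊗ₜ a)) = (antipode k).lTensor H y * (1 ⊗ₜ a) := by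
    intro a y
    induction y with
    | zero => simp
    | add x y hx hy => rw [add_tmul, map_add, map_add, hx, hy, map_add, add_mul]
    | tmul p q => simp [T, m]
  simp_rw [← hT]
  rw [← lTensor_comul_comul h T r]
  simp only [T, m, LinearMap.comp_apply,
    LinearMap.lTensor_tmul, mul_antipode_rTensor_comul_apply, Algebra.algebraMap_eq_smul_one,
    tmul_smul]
  simp only [smul_tmul', ← sum_tmul, sum_smul_counit]

/-- The antipode is an anti-endomorphism of coalgebras. -/
theorem comul_antipode (h : H) :
    comul (R := k) (antipode k h) = TensorProduct.map (antipode k) (antipode k)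
      (TensorProduct.comm k H H (comul (R := k) h)) := by
  let G : H →ₗ[k] H ⊗[k] H := TensorProduct.map (antipode k) (antipode k) ∘ₗ
    (TensorProduct.comm k H H).toLinearMap ∘ₗ comul
  -- Both sides of the claim are convolution inverses of Δ in Hom(H, H ⊗ H): the left side is a
  -- right inverse, so it is enough that `G` is a left inverse.
  suffices hG : WithConv.toConv G * WithConv.toConv (comul (R := k) (A := H)) = 1 by
    have := left_inv_eq_right_inv hG (LinearMap.comul_right_inv (R := k) (C := H))
    exact (LinearMap.congr_fun (congrArg WithConv.ofConv this) h).symm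
  ext x
  have hT : ∃ T : H ⊗[k] (H ⊗[k] H) →ₗ[k] H ⊗[k] H, ∀ a b c, T (a ⊗ₜ (b ⊗ₜ c)) =
      (antipode k b ⊗ₜ antipode k a) * comul (R := k) c :=
    ⟨LinearMap.mul' k (H ⊗[k] H) ∘ₗ TensorProduct.map
      (TensorProduct.map (antipode k) (antipode k) ∘ₗ (TensorProduct.comm k H H).toLinearMap)
      comul ∘ₗ (TensorProduct.assoc k H H H).symm.toLinearMap,
      fun a b c => by simp⟩
  obtain ⟨T, hT⟩ := hT
  have h₁ : ∀ (a : H) (y : H ⊗[k] H), T (TensorProduct.assoc k H H H (y ⊗ₜ a)) =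
      TensorProduct.map (antipode k) (antipode k) (TensorProduct.comm k H H y) *
        comul (R := k) a := by
    intro a y
    induction y with
    | zero => simp
    | add x y hx hy => rw [add_tmul, map_add, map_add, hx, hy, map_add, map_add, add_mul]
    | tmul p q => simp [hT]
  have h₂ : ∀ a b : H, T (a ⊗ₜ comul (R := k) b) = 1 ⊗ₜ (antipode k a * b) := by
    intro a b
    have := sum_antipode_tmul_one_mul_comul (ℛ k b)
    have h₃ := congrArg (fun z => ((1 : H) ⊗ₜ[k] antipode k a) * z) this
    simp only [Finset.mul_sum, ← mul_assoc, Algebra.TensorProduct.tmul_mul_tmul, one_mul,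
      mul_one] at h₃
    rw [← h₃, ← (ℛ k b).eq]
    simp [tmul_sum, hT]
  rw [(ℛ k x).convMul_apply]
  have h₄ := lTensor_comul_comul x T (ℛ k x)
  simp only [h₁, h₂] at h₄
  change ∑ i ∈ (ℛ k x).index, TensorProduct.map (antipode k) (antipode k)
      (TensorProduct.comm k H H (comul (R := k) ((ℛ k x).left i))) *
        comul (R := k) ((ℛ k x).right i) = _
  rw [← h₄, ← tmul_sum, sum_antipode_mul_eq_algebraMap_counit]
  simp [Algebra.algebraMap_eq_smul_one, Algebra.TensorProduct.one_def]

theorem antipode_sq_mul (a b : H) :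
    antipode k (antipode k (a * b)) = antipode k (antipode k a) * antipode k (antipode k b) := by
  rw [antipode_mul_antidistrib, antipode_mul_antidistrib]

theorem comul_antipode_sq (h : H) :
    comul (R := k) (antipode k (antipode k h)) =
      TensorProduct.map (antipode k ∘ₗ antipode k) (antipode k ∘ₗ antipode k)
        (comul (R := k) h) := by
  rw [comul_antipode, comul_antipode]
  generalize comul (R := k) h = y
  induction y with
  | zero => simp
  | add x y hx hy => simp only [map_add, hx, hy]
  | tmul p q => simp

end Antipode

/-! ### Contracting the first tensor leg -/

section SliceLeft

variable {k : Type u} [Field k] {H : Type v} [Ring H] [Algebra k H]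

/-- The slice map `a ⊗ b ↦ f(a) b`. -/
def sliceLeft (f : Module.Dual k H) : H ⊗[k] H →ₗ[k] H :=
  sliceRight f ∘ₗ (TensorProduct.comm k H H).toLinearMap

@[simp] theorem sliceLeft_tmul (f : Module.Dual k H) (a b : H) :
    sliceLeft f (a ⊗ₜ b) = f a • b := by
  simp [sliceLeft]

theorem apply_sliceRight (f g : Module.Dual k H) (x : H ⊗[k] H) :
    f (sliceRight g x) = g (sliceLeft f x) := by
  induction x with
  | zero => simp
  | add x y hx hy => simp [hx, hy]
  | tmul p q => simp [mul_comm]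

theorem sliceLeft_mul_one_tmul (f : Module.Dual k H) (a : H) (x : H ⊗[k] H) :
    sliceLeft f (x * (1 ⊗ₜ a)) = sliceLeft f x * a := by
  induction x with
  | zero => simp
  | add x y hx hy => simp [add_mul, hx, hy]
  | tmul p q => simp

theorem sliceLeft_tmul_one_mul (f : Module.Dual k H) (a : H) (x : H ⊗[k] H) :
    sliceLeft f ((a ⊗ₜ 1) * x) = sliceLeft (f ∘ₗ LinearMap.mulLeft k a) x := by
  induction x with
  | zero => simp
  | add x y hx hy => simp [mul_add, hx, hy]
  | tmul p q => simp

theorem sliceRight_rTensor (f : Module.Dual k H) (g : H →ₗ[k] H) (x : H ⊗[k] H) :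
    sliceRight f (g.rTensor H x) = g (sliceRight f x) := by
  induction x with
  | zero => simp
  | add x y hx hy => simp [hx, hy]
  | tmul p q => simp

theorem sliceLeft_rTensor (f : Module.Dual k H) (g : H →ₗ[k] H) (x : H ⊗[k] H) :
    sliceLeft f (g.rTensor H x) = sliceLeft (f ∘ₗ g) x := by
  induction x with
  | zero => simp
  | add x y hx hy => simp [hx, hy]
  | tmul p q => simp

theorem sliceLeft_lTensor (f : Module.Dual k H) (g : H →ₗ[k] H) (x : H ⊗[k] H) :
    sliceLeft f (g.lTensor H x) = g (sliceLeft f x) := by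
  induction x with
  | zero => simp
  | add x y hx hy => simp [hx, hy]
  | tmul p q => simp

theorem sliceRight_map_comm (f : Module.Dual k H) (g : H →ₗ[k] H) (x : H ⊗[k] H) :
    sliceRight f (TensorProduct.map g g (TensorProduct.comm k H H x)) =
      g (sliceLeft (f ∘ₗ g) x) := by
  induction x with
  | zero => simp
  | add x y hx hy => simp [hx, hy]
  | tmul p q => simp

theorem sliceRight_map (f : Module.Dual k H) (g : H →ₗ[k] H) (x : H ⊗[k] H) :
    sliceRight f (TensorProduct.map g g x) = g (sliceRight (f ∘ₗ g) x) := by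
  induction x with
  | zero => simp
  | add x y hx hy => simp [hx, hy]
  | tmul p q => simp

theorem sliceRight_smul (c : k) (f : Module.Dual k H) (x : H ⊗[k] H) :
    sliceRight (c • f) x = c • sliceRight f x := by
  simp [sliceRight, LinearMap.lTensor_smul]

end SliceLeft

/-! ### Convolution of linear forms -/

section Convolution

variable {k : Type u} [Field k] {H : Type v} [Ring H] [Bialgebra k H]

/-- The convolution product of linear forms, `(f * g)(h) = f(h₁) g(h₂)`. -/
def dualConv (f g : Module.Dual k H) : Module.Dual k H :=
  f ∘ₗ sliceRight g ∘ₗ comul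

theorem sliceRight_comul_counit (h : H) :
    sliceRight (counit (R := k)) (comul (R := k) h) = h := by
  simp [sliceRight]

end Convolution

/-! ### Integrals and the Frobenius structure of H -/

section Integrals

variable {k : Type u} [Field k] {H : Type v} [Ring H] [HopfAlgebra k H]

/-- By coassociativity the operators h ↦ h₁ f(h₂) compose as their forms convolve; a convolution
idempotent therefore gives an idempotent operator. -/
theorem sliceRight_comul_sliceRight_comul (f g : Module.Dual k H) (h : H) :
    sliceRight f (comul (R := k) (sliceRight g (comul (R := k) h))) =
      sliceRight (dualConv f g) (comul (R := k) h) := by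
  let T : H ⊗[k] (H ⊗[k] H) →ₗ[k] H :=
    (TensorProduct.rid k H).toLinearMap ∘ₗ (f ∘ₗ sliceRight g).lTensor H
  have hT : ∀ (a : H) (y : H ⊗[k] H),
      T (TensorProduct.assoc k H H H (y ⊗ₜ a)) = g a • sliceRight f y := by
    intro a y
    induction y with
    | zero => simp
    | add x y hx hy => rw [add_tmul, map_add, map_add, hx, hy, map_add, smul_add]
    | tmul p q => simp [T, mul_smul]
  have := lTensor_comul_comul h T (ℛ k h)
  simp only [hT] at this
  rw [← (ℛ k h).eq]
  simp only [map_sum, sliceRight_tmul, map_smul, ← this]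
  simp [T, dualConv]

/-- A left and right integral `Lam` of `H` with `ε(Lam) = 1`, together with an integral `lam` of
the dual of `H` with `lam(1) = 1`. -/
structure IsIntegralPair (lam : Module.Dual k H) (Lam : H) : Prop where
  mul_left : ∀ h : H, h * Lam = counit (R := k) h • Lam
  mul_right : ∀ h : H, Lam * h = counit (R := k) h • Lam
  counit_eq_one : counit (R := k) Lam = 1
  slice : ∀ h : H, sliceRight lam (comul (R := k) h) = lam h • 1
  map_one : lam 1 = 1

theorem antipode_rTensor_mul_tmul (z : H ⊗[k] H) (p q : H) :
    (antipode k p ⊗ₜ 1) * (antipode k).rTensor H z * (1 ⊗ₜ q) =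
      (antipode k).rTensor H (z * (p ⊗ₜ q)) := by
  induction z with
  | zero => simp
  | add x y hx hy => rw [map_add, mul_add, add_mul, add_mul, map_add, hx, hy]
  | tmul a b => simp [antipode_mul_antidistrib]

namespace IsIntegralPair

variable {lam : Module.Dual k H} {Lam : H} (I : IsIntegralPair lam Lam)
include I

/-- Write 1 ⊗ y = Σ (S(y₁) ⊗ 1)Δ(y₂). Then Δ(y₂)Δ(x) = Δ(y₂x), which the integral contracts to
lam(y₂x)1. -/
theorem sliceRight_mulLeft_comul (x y : H) {ι : Type*} (r : Repr k y ι) :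
    sliceRight (lam ∘ₗ LinearMap.mulLeft k y) (comul (R := k) x) =
      ∑ i ∈ r.index, lam (r.right i * x) • antipode k (r.left i) := by
  rw [← sliceRight_one_tmul_mul, ← sum_antipode_tmul_one_mul_comul r, Finset.sum_mul, map_sum]
  refine Finset.sum_congr rfl fun i _ => ?_
  rw [mul_assoc, ← Bialgebra.comul_mul, sliceRight_tmul_one_mul, I.slice, mul_smul_comm, mul_one]

/-- Apply lam to ε(x)1 = Σ S(x₁)x₂ and use lam(1) = 1. -/
theorem counit_eq_zero_of_forall {x : H} {ι : Type*}
    (r : Repr k x ι) (hr : ∀ i ∈ r.index, ∀ y, lam (y * r.right i) = 0) :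
    counit (R := k) x = 0 := by
  have := congrArg lam (sum_antipode_mul_eq_smul (R := k) r)
  rw [map_sum, Finset.sum_eq_zero fun i hi => hr i hi _, map_smul, I.map_one, smul_eq_mul,
    mul_one] at this
  exact this.symm

/-- The radical N = {x | lam(Hx) = 0} satisfies Δ(N) ⊆ H ⊗ N. For x in N the previous formula gives
Σ x₁ lam(y x₂) = 0; with the left legs taken from a basis, each right leg must lie in N. -/
theorem exists_repr {x : H} (hx : ∀ y, lam (y * x) = 0) :
    ∃ r : Repr k x (Module.Free.ChooseBasisIndex k H),
      ∀ i ∈ r.index, ∀ y, lam (y * r.right i) = 0 := by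
  let e := Module.Free.chooseBasis k H
  obtain ⟨c, hc⟩ := TensorProduct.eq_repr_basis_left e (comul (R := k) x)
  refine ⟨⟨c.support, e, c, hc⟩, fun i _ y => ?_⟩
  have h := I.sliceRight_mulLeft_comul x y (ℛ k y)
  rw [Finset.sum_eq_zero fun i _ => by rw [hx, zero_smul], ← hc, Finsupp.sum, map_sum] at h
  simp only [sliceRight_tmul, LinearMap.comp_apply, LinearMap.mulLeft_apply] at h
  by_cases hi : i ∈ c.support
  · exact linearIndependent_iff'.1 e.linearIndependent c.support _ h i hi
  · rw [Finsupp.notMem_support_iff] at hi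
    simp [hi]

/-- Nondegeneracy of lam: Δ(N) ⊆ H ⊗ N and ε vanishes on N, so x = Σ x₁ ε(x₂) = 0 for x in N. -/
theorem eq_zero_of_forall {x : H} (hx : ∀ y, lam (y * x) = 0) : x = 0 := by
  obtain ⟨r, hr⟩ := I.exists_repr hx
  rw [← sum_smul_counit r]
  refine Finset.sum_eq_zero fun i hi => ?_
  obtain ⟨r', hr'⟩ := I.exists_repr (hr i hi)
  rw [I.counit_eq_zero_of_forall r' hr', zero_smul]

theorem ne_zero : lam Lam ≠ 0 := fun h => by
  have h₀ : Lam = 0 := I.eq_zero_of_forall fun y => by rw [I.mul_left, map_smul, h, smul_zero]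
  have := I.counit_eq_one
  rw [h₀, map_zero] at this
  exact zero_ne_one this

theorem integral_ne_zero : Lam ≠ 0 := fun h => I.ne_zero (by rw [h, map_zero])

/-- The Casimir property of `S(Lam₁) ⊗ Lam₂`. -/
theorem casimir (h : H) :
    (h ⊗ₜ[k] (1 : H)) * (antipode k).rTensor H (comul (R := k) Lam) =
      (antipode k).rTensor H (comul (R := k) Lam) * (1 ⊗ₜ h) := by
  set c := (antipode k).rTensor H (comul (R := k) Lam) with hc
  let r := ℛ k h
  -- `G` sandwiches `c`: a ⊗ b ↦ (a ⊗ 1)c(1 ⊗ b). It is applied to Σ h₁S(h₂) ⊗ h₃ = 1 ⊗ h. Since `G`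
  -- sends S(p) ⊗ q to S(Λ₁p) ⊗ Λ₂q, the factors with h₂, h₃ assemble to ΔΛ Δ(h₂) = ε(h₂)ΔΛ.
  let G : H ⊗[k] H →ₗ[k] H ⊗[k] H :=
    TensorProduct.lift ((LinearMap.mul k (H ⊗[k] H) ∘ₗ (LinearMap.mulRight k c) ∘ₗ
      (Algebra.TensorProduct.includeLeft : H →ₐ[k] H ⊗[k] H).toLinearMap).compl₂
      (Algebra.TensorProduct.includeRight : H →ₐ[k] H ⊗[k] H).toLinearMap)
  have hG : ∀ a b, G (a ⊗ₜ b) = (a ⊗ₜ 1) * c * (1 ⊗ₜ b) := fun a b => rfl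
  have h₁ : ∀ a y, G ((a ⊗ₜ 1) * y) = (a ⊗ₜ 1) * G y := by
    intro a y
    induction y with
    | zero => simp
    | add x y hx hy => rw [mul_add, map_add, map_add, mul_add, hx, hy]
    | tmul p q =>
      rw [hG, Algebra.TensorProduct.tmul_mul_tmul, hG, one_mul, ← mul_assoc, ← mul_assoc,
        Algebra.TensorProduct.tmul_mul_tmul, one_mul]
  have h₂ : ∀ y, G ((antipode k).rTensor H y) =
      (antipode k).rTensor H (comul (R := k) Lam * y) := by
    intro y
    induction y with
    | zero => simp
    | add x y hx hy => rw [mul_add, map_add, map_add, map_add, hx, hy]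
    | tmul p q => rw [LinearMap.rTensor_tmul, hG, hc, antipode_rTensor_mul_tmul]
  have h₃ := congrArg G (sum_tmul_one_mul_antipode_comul r)
  rw [hG, ← Algebra.TensorProduct.one_def, one_mul, map_sum] at h₃
  rw [← h₃]
  simp only [h₁, h₂, ← Bialgebra.comul_mul, I.mul_right, map_smul, mul_smul_comm, ← smul_mul_assoc]
  rw [← Finset.sum_mul]
  simp only [smul_tmul', ← sum_tmul]
  rw [sum_smul_counit r]

theorem sliceRight_antipode_comul :
    sliceRight lam ((antipode k).rTensor H (comul (R := k) Lam)) = lam Lam • 1 := by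
  rw [sliceRight_rTensor, I.slice, map_smul, antipode_one]

/-- `S(Lam₁) lam(Lam₂ h) = lam(Lam) h`. -/
theorem sliceRight_mulRight (h : H) :
    sliceRight (lam ∘ₗ LinearMap.mulRight k h)
      ((antipode k).rTensor H (comul (R := k) Lam)) = lam Lam • h := by
  rw [← sliceRight_mul_one_tmul, ← I.casimir, sliceRight_tmul_one_mul,
    I.sliceRight_antipode_comul, mul_smul_comm, mul_one]

theorem antipode_surjective : Function.Surjective (antipode k (A := H)) := by
  intro h
  have := I.sliceRight_mulRight h
  rw [sliceRight_rTensor] at this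
  refine ⟨(lam Lam)⁻¹ • sliceRight (lam ∘ₗ LinearMap.mulRight k h) (comul (R := k) Lam), ?_⟩
  rw [map_smul, this, inv_smul_smul₀ I.ne_zero]

/-- Take h = Λ in the dual basis formula: lam(Λ₂Λ) = ε(Λ₂) lam(Λ), so the left side collapses to
lam(Λ)S(Λ). -/
theorem antipode_integral : antipode k Lam = Lam := by
  have h := I.sliceRight_mulRight Lam
  have h₁ : lam ∘ₗ LinearMap.mulRight k Lam = lam Lam • counit (R := k) (A := H) := by
    ext x
    simp [I.mul_left, mul_comm]
  rw [h₁, sliceRight_smul, sliceRight_rTensor, sliceRight_comul_counit] at h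
  exact smul_right_injective H I.ne_zero h

variable [Module.Finite k H]

/-- The antipode reverses Δ, so it turns a right integral into a left one; S is injective because it
is surjective in finite dimension. -/
theorem sliceLeft_antipode (h : H) :
    sliceLeft (lam ∘ₗ antipode k) (comul (R := k) h) = lam (antipode k h) • 1 := by
  have h₁ := I.slice (antipode k h)
  rw [comul_antipode, sliceRight_map_comm] at h₁
  refine (LinearMap.injective_iff_surjective (f := antipode k (A := H))).2 I.antipode_surjective ?_
  rw [h₁, map_smul, antipode_one]

/-- Evaluate lam(S(h₁)) lam(h₂) in two ways: contracting the first leg gives lam(S(h)), contracting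
the second gives lam(h). -/
theorem map_antipode (h : H) : lam (antipode k h) = lam h := by
  have h₁ := congrArg lam (I.sliceLeft_antipode h)
  rw [← apply_sliceRight, I.slice] at h₁
  simpa [I.map_one] using h₁.symm

theorem comp_antipode : lam ∘ₗ antipode k = lam := LinearMap.ext I.map_antipode

theorem slice_left (h : H) : sliceLeft lam (comul (R := k) h) = lam h • 1 := by
  have := I.sliceLeft_antipode h
  rwa [I.comp_antipode, I.map_antipode] at this

/-- The Nakayama automorphism of `lam` is the square of the antipode. -/
theorem map_mul (h y : H) : lam (h * y) = lam (y * antipode k (antipode k h)) := by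
  have h₁ : sliceRight (lam ∘ₗ LinearMap.mulLeft k h)
      ((antipode k).rTensor H (comul (R := k) Lam)) =
      lam Lam • antipode k (antipode k h) := by
    have hr := sum_antipode_tmul_one_mul_comul (ℛ k h)
    have h₂ : ((1 : H) ⊗ₜ[k] h) * comul (R := k) Lam =
        (antipode k h ⊗ₜ 1) * comul (R := k) Lam := by
      rw [← hr, Finset.sum_mul]
      simp only [mul_assoc, ← Bialgebra.comul_mul, I.mul_left, map_smul, mul_smul_comm,
        ← smul_mul_assoc]
      rw [← Finset.sum_mul]
      simp only [smul_tmul', ← sum_tmul, ← map_smul]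
      rw [← map_sum, sum_smul_counit]
    rw [sliceRight_rTensor, ← sliceRight_one_tmul_mul, h₂, sliceRight_tmul_one_mul, I.slice,
      mul_smul_comm, mul_one, map_smul]
  rw [← I.sliceRight_mulRight] at h₁
  -- The dual basis formula for the other leg: lam(y S(Λ₁))Λ₂ = lam(Λ) y. Pairing the two
  -- expressions for lam(Λ)S²(h) with lam(y ·) then cancels Λ.
  have h₃ : sliceLeft (lam ∘ₗ LinearMap.mulLeft k y)
      ((antipode k).rTensor H (comul (R := k) Lam)) = lam Lam • y := by
    rw [← sliceLeft_tmul_one_mul, I.casimir, sliceLeft_mul_one_tmul, sliceLeft_rTensor,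
      I.comp_antipode, I.slice_left, smul_mul_assoc, one_mul]
  have h₄ := congrArg (lam ∘ₗ LinearMap.mulLeft k y) h₁
  rw [apply_sliceRight, apply_sliceRight, h₃] at h₄
  simp only [map_smul, LinearMap.comp_apply, LinearMap.mulLeft_apply, LinearMap.mulRight_apply]
    at h₄
  exact smul_right_injective k I.ne_zero h₄

/-- Using lam ∘ S = lam together with the Nakayama rule twice, lam(hx) = lam(S(x)S(h)) =
lam(S(S²(x)h)) = lam(S²(x)h) = lam(hS⁴(x)). -/
theorem antipode_four (x : H) :
    antipode k (antipode k (antipode k (antipode k x))) = x := by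
  rw [← sub_eq_zero]
  refine I.eq_zero_of_forall fun h => ?_
  have h₁ := I.map_antipode (h * x)
  rw [antipode_mul_antidistrib, I.map_mul, ← antipode_mul_antidistrib, I.map_antipode,
    I.map_mul] at h₁
  rw [mul_sub, map_sub, h₁, sub_self]

/-- The dual basis formula writes lam(Λ)F as a sum of rank one operators, whose traces are
evaluations. -/
theorem trace_eq (F : Module.End k H) {ι : Type*} (r : Repr k Lam ι) :
    lam Lam * LinearMap.trace k H F =
      ∑ i ∈ r.index, lam (r.right i * F (antipode k (r.left i))) := by
  have hF : lam Lam • F = ∑ i ∈ r.index,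
      (lam ∘ₗ LinearMap.mulLeft k (r.right i)).smulRight (F (antipode k (r.left i))) := by
    ext h
    have := congrArg F (I.sliceRight_mulRight h)
    rw [← r.eq] at this
    simpa using this.symm
  rw [← smul_eq_mul, ← map_smul, hF, map_sum]
  simp

/-- The Nakayama rule absorbs S² and leaves lam(S(Λ₁)Λ₂) = ε(Λ) lam(1). -/
theorem trace_antipode_sq :
    lam Lam * LinearMap.trace k H (antipode k ∘ₗ antipode k) = 1 := by
  rw [I.trace_eq _ (ℛ k Lam)]
  simp only [LinearMap.comp_apply, ← I.map_mul]
  rw [← map_sum, sum_antipode_mul_eq_smul, I.counit_eq_one, one_smul, I.map_one]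

/-- After the Nakayama rule the sum is f(S(Λ₁)) lam(S(Λ₂)Λ₃) = f(S(Λ)), and S(Λ) = Λ. -/
theorem trace_antipode_sq_comp (f : Module.Dual k H) :
    lam Lam * LinearMap.trace k H
      ((antipode k ∘ₗ antipode k) ∘ₗ sliceRight f ∘ₗ comul) = f Lam := by
  rw [I.trace_eq _ (ℛ k Lam)]
  simp only [LinearMap.comp_apply, ← I.map_mul, comul_antipode, sliceRight_map_comm]
  simp only [← sliceLeft_lTensor, ← sliceLeft_mul_one_tmul]
  rw [← map_sum, ← map_sum, sum_antipode_comul_mul_one_tmul]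
  simp [I.antipode_integral, I.map_one]

end IsIntegralPair

end Integrals

/-! ### Traces of involutions commuting with an idempotent -/

section Traces

variable {k : Type u} [Field k]

theorem exists_trace_eq_natCast {V : Type v} [AddCommGroup V] [Module k V] [Module.Finite k V]
    {e : Module.End k V} (he : IsIdempotentElem e) :
    LinearMap.trace k V e = (Module.finrank k (LinearMap.range e) : k) :=
  (LinearMap.IsIdempotentElem.isProj_range e he).trace

/-- As |a - b| ≤ a + b, only m = 0, ±1 could occur: m < 0 would force a ≤ 0, m = 0 is excluded, and
m > 0 forces b ≤ 0. -/
theorem eq_zero_of_sub_eq_add_mul {a b m : ℤ} (ha : 0 < a) (hb : 0 ≤ b) (hab : a - b ≠ 0)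
    (h : a - b = (a + b) * m) : b = 0 := by
  rcases lt_trichotomy m 0 with hm | hm | hm
  · nlinarith
  · subst hm
    simp at h
    exact absurd h hab
  · nlinarith

/-- If `s` is an involution with a nonzero fixed vector, commuting with an idempotent `t`, and
`tr s = (dim V) tr (s t) ≠ 0`, then `s = 1`. -/
theorem eq_one_of_trace_eq [CharZero k] {V : Type v} [AddCommGroup V] [Module k V]
    [Module.Finite k V] {s t : Module.End k V} (hs : s * s = 1) (ht : t * t = t)
    (hst : s * t = t * s) {x : V} (hx : x ≠ 0) (hsx : s x = x)
    (h₀ : LinearMap.trace k V s ≠ 0)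
    (h : LinearMap.trace k V s = Module.finrank k V * LinearMap.trace k V (s * t)) : s = 1 := by
  -- Projections onto the ±1 eigenspaces of `s`. They commute with `t`, so `p * t` and `q * t` are
  -- idempotent too and all traces in sight are integers.
  set p : Module.End k V := (2 : k)⁻¹ • (1 + s) with hp
  set q : Module.End k V := (2 : k)⁻¹ • (1 - s) with hq
  have h2 : (2 : k)⁻¹ * (2 : k)⁻¹ * 2 = (2 : k)⁻¹ := by norm_num
  have hpp : p * p = p := by
    rw [hp, smul_mul_smul_comm]
    have : (1 + s) * (1 + s) = (2 : k) • (1 + s) := by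
      rw [mul_add, add_mul, add_mul, hs, two_smul]
      simp only [mul_one, one_mul]
      abel
    rw [this, smul_smul, h2]
  have hqq : q * q = q := by
    rw [hq, smul_mul_smul_comm]
    have : (1 - s) * (1 - s) = (2 : k) • (1 - s) := by
      rw [mul_sub, sub_mul, sub_mul, hs, two_smul]
      simp only [mul_one, one_mul]
      abel
    rw [this, smul_smul, h2]
  have hpt : p * t = t * p := by
    rw [hp, smul_mul_assoc, mul_smul_comm, add_mul, mul_add, hst, one_mul, mul_one]
  have hqt : q * t = t * q := by
    rw [hq, smul_mul_assoc, mul_smul_comm, sub_mul, mul_sub, hst, one_mul, mul_one]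
  have hpq : p - q = s := by
    rw [hp, hq, ← smul_sub]
    have : (1 + s) - (1 - s) = (2 : k) • s := by rw [two_smul]; abel
    rw [this, smul_smul]
    norm_num
  have hpq' : p + q = 1 := by
    rw [hp, hq, ← smul_add]
    have : (1 + s) + (1 - s) = (2 : k) • (1 : Module.End k V) := by rw [two_smul]; abel
    rw [this, smul_smul]
    norm_num
  have idem : ∀ e : Module.End k V, e * e = e → e * t = t * e → IsIdempotentElem (e * t) := by
    intro e he het
    change e * t * (e * t) = e * t
    rw [mul_assoc, ← mul_assoc t, ← het, mul_assoc e t t, ht, ← mul_assoc, he]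
  have h₁ := exists_trace_eq_natCast (e := p) hpp
  have h₂ := exists_trace_eq_natCast (e := q) hqq
  have h₃ := exists_trace_eq_natCast (idem p hpp hpt)
  have h₄ := exists_trace_eq_natCast (idem q hqq hqt)
  set a := Module.finrank k (LinearMap.range p)
  set b := Module.finrank k (LinearMap.range q)
  set c := Module.finrank k (LinearMap.range (p * t))
  set d := Module.finrank k (LinearMap.range (q * t))
  have hs' : LinearMap.trace k V s = a - b := by rw [← hpq, map_sub, h₁, h₂]
  have hst' : LinearMap.trace k V (s * t) = c - d := by rw [← hpq, sub_mul, map_sub, h₃, h₄]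
  have hn : (Module.finrank k V : k) = a + b := by
    rw [← LinearMap.trace_one, ← hpq', map_add, h₁, h₂]
  have ha : 0 < a := by
    rw [Nat.pos_iff_ne_zero]
    intro ha
    rw [ha, Nat.cast_zero, LinearMap.IsIdempotentElem.trace_eq_zero_iff hpp] at h₁
    apply hx
    have := LinearMap.congr_fun h₁ x
    simp only [hp, LinearMap.smul_apply, LinearMap.add_apply, hsx, Module.End.one_apply,
      LinearMap.zero_apply] at this
    rw [← two_smul k, smul_smul] at this
    simpa using this
  rw [hs', hst', hn] at h
  rw [hs'] at h₀
  have hb : (b : ℤ) = 0 := by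
    refine eq_zero_of_sub_eq_add_mul (a := a) (m := c - d) (by exact_mod_cast ha) (by positivity) ?_ ?_
    · intro h'
      apply h₀
      exact_mod_cast congrArg (Int.cast : ℤ → k) h'
    · have : (((a : ℤ) - b : ℤ) : k) = (((a + b) * (c - d) : ℤ) : k) := by
        push_cast
        exact h
      exact_mod_cast this
  rw [Int.natCast_eq_zero.1 hb, Nat.cast_zero,
    LinearMap.IsIdempotentElem.trace_eq_zero_iff hqq] at h₂
  rw [← hpq', h₂, add_zero, ← hpq, h₂, sub_zero]

end Traces

/-! ### The regular character and the Larson–Radford theorem -/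

section RegularCharacter

variable {k : Type u} [Field k] {H : Type v} [Ring H] [HopfAlgebra k H] [Module.Finite k H]

theorem trace_mulLeft_tensor (y : H ⊗[k] H) :
    LinearMap.trace k (H ⊗[k] H) (LinearMap.mulLeft k y) =
      (LinearMap.trace k H ∘ₗ LinearMap.mul k H)
        (sliceRight (LinearMap.trace k H ∘ₗ LinearMap.mul k H) y) := by
  induction y with
  | zero => simp
  | add x y hx hy =>
    rw [map_add, map_add, ← hx, ← hy, ← map_add]
    congr 1
    ext
    simp [add_mul]
  | tmul a b =>
    have : LinearMap.mulLeft k (a ⊗ₜ[k] b) =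
        TensorProduct.map (LinearMap.mulLeft k a) (LinearMap.mulLeft k b) := by
      ext
      simp
    rw [this, LinearMap.trace_tensorProduct', sliceRight_tmul, map_smul, smul_eq_mul, mul_comm]
    rfl

/-- The map a ⊗ b ↦ Δ(a)(1 ⊗ b) intertwines h ⊗ 1 with Δ(h), and the antipode supplies its inverse
(one-sided by computation, two-sided by finite dimension). So H ⊗ H is dim H copies of the regular
representation. -/
theorem trace_mulLeft_comul (h : H) :
    LinearMap.trace k (H ⊗[k] H) (LinearMap.mulLeft k (comul (R := k) h)) =
      LinearMap.trace k H (LinearMap.mul k H h) * Module.finrank k H := by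
  let ψ : Module.End k (H ⊗[k] H) := LinearMap.mul' k (H ⊗[k] H) ∘ₗ
    TensorProduct.map comul (Algebra.TensorProduct.includeRight : H →ₐ[k] H ⊗[k] H).toLinearMap
  let φ : Module.End k (H ⊗[k] H) := LinearMap.mul' k (H ⊗[k] H) ∘ₗ
    TensorProduct.map ((antipode k).lTensor H ∘ₗ comul)
      (Algebra.TensorProduct.includeRight : H →ₐ[k] H ⊗[k] H).toLinearMap
  have hψ : ∀ a b, ψ (a ⊗ₜ b) = comul (R := k) a * (1 ⊗ₜ b) := fun a b => rfl
  have hφ : ∀ a b, φ (a ⊗ₜ b) = (antipode k).lTensor H (comul (R := k) a) * (1 ⊗ₜ b) :=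
    fun a b => rfl
  have h₁ : ψ * φ = 1 := by
    have hr : ∀ y b, ψ (y * (1 ⊗ₜ b)) = ψ y * (1 ⊗ₜ b) := by
      intro y b
      induction y with
      | zero => simp
      | add x y hx hy => rw [add_mul, map_add, map_add, add_mul, hx, hy]
      | tmul p q =>
        rw [Algebra.TensorProduct.tmul_mul_tmul, hψ, hψ, mul_assoc,
          Algebra.TensorProduct.tmul_mul_tmul, mul_one, one_mul]
    refine TensorProduct.ext' fun a b => ?_
    rw [Module.End.mul_apply, hφ, hr, ← (ℛ k a).eq]
    simp only [map_sum, LinearMap.lTensor_tmul, hψ]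
    rw [sum_comul_mul_one_tmul_antipode]
    simp
  have h₂ : φ * ψ = 1 := mul_eq_one_comm.1 h₁
  have h₃ : LinearMap.mulLeft k (comul (R := k) h) * ψ =
      ψ * TensorProduct.map (LinearMap.mulLeft k h) LinearMap.id := by
    refine TensorProduct.ext' fun a b => ?_
    simp [hψ, ← mul_assoc]
  calc LinearMap.trace k (H ⊗[k] H) (LinearMap.mulLeft k (comul (R := k) h))
      = LinearMap.trace k (H ⊗[k] H) (LinearMap.mulLeft k (comul (R := k) h) * ψ * φ) := by
        rw [mul_assoc, h₁, mul_one]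
    _ = LinearMap.trace k (H ⊗[k] H)
          (φ * (ψ * TensorProduct.map (LinearMap.mulLeft k h) LinearMap.id)) := by
        rw [h₃, LinearMap.trace_mul_comm]
    _ = _ := by
        rw [← mul_assoc, h₂, one_mul, LinearMap.trace_tensorProduct', LinearMap.trace_id]
        rfl

theorem dualConv_normalizedRegularCharacter :
    dualConv (normalizedRegularCharacter k H) (normalizedRegularCharacter k H) =
      normalizedRegularCharacter k H := by
  ext h
  have h₁ := trace_mulLeft_comul (k := k) h
  rw [trace_mulLeft_tensor] at h₁
  simp only [normalizedRegularCharacter, dualConv, sliceRight_smul, LinearMap.comp_apply,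
    LinearMap.smul_apply, map_smul, smul_eq_mul] at h₁ ⊢
  rw [h₁]
  by_cases hn : (Module.finrank k H : k) = 0
  · simp [hn]
  · field_simp

namespace IsIntegralPair

variable {lam : Module.Dual k H} {Lam : H} (I : IsIntegralPair lam Lam)
include I

/-- Left multiplication by Λ is the rank one operator h ↦ ε(h)Λ, of trace ε(Λ) = 1. -/
theorem normalizedRegularCharacter_integral :
    normalizedRegularCharacter k H Lam = (Module.finrank k H : k)⁻¹ := by
  have : LinearMap.mul k H Lam = (counit (R := k) (A := H)).smulRight Lam := by
    ext h
    simp [I.mul_right]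
  simp [normalizedRegularCharacter, this, I.counit_eq_one]

/-- S² is an algebra automorphism, bijective since S⁴ = 1; it conjugates multiplication by h into
multiplication by S²(h). -/
theorem normalizedRegularCharacter_antipode_sq :
    normalizedRegularCharacter k H ∘ₗ (antipode k ∘ₗ antipode k) =
      normalizedRegularCharacter k H := by
  let e : H ≃ₗ[k] H := LinearEquiv.ofLinearMap (antipode k ∘ₗ antipode k) (antipode k ∘ₗ antipode k)
    (LinearMap.ext I.antipode_four) (LinearMap.ext I.antipode_four)
  ext h
  have : LinearMap.mul k H (e h) = e.conj (LinearMap.mul k H h) := by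
    ext x
    rw [LinearEquiv.conj_apply]
    change _ = e (h * e.symm x)
    have h₁ : e (h * e.symm x) = e h * e (e.symm x) := antipode_sq_mul _ _
    rw [h₁, e.apply_symm_apply]
    rfl
  change _ * LinearMap.trace k H (LinearMap.mul k H (e h)) = _
  rw [this, LinearMap.trace_conj']
  rfl

/-- The theorem of Larson and Radford, given integrals in `H` and in its dual. -/
theorem antipode_sq [CharZero k] (x : H) : antipode k (antipode k x) = x := by
  set e₀ := normalizedRegularCharacter k H
  have h₁ : ((Module.finrank k H : k)) ≠ 0 := by
    have : Nontrivial H := ⟨⟨Lam, 0, I.integral_ne_zero⟩⟩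
    exact_mod_cast Module.finrank_pos.ne'
  -- Here `t` is the idempotent h ↦ h₁ e₀(h₂). The trace formulas give lam(Λ) tr(S²) = 1 and lam(Λ)
  -- tr(S²t) = e₀(Λ) = 1/dim H.
  have key := eq_one_of_trace_eq (k := k) (V := H) (s := antipode k ∘ₗ antipode k)
    (t := sliceRight e₀ ∘ₗ comul) (x := 1) (LinearMap.ext I.antipode_four) ?_ ?_ ?_ ?_ ?_ ?_
  · exact LinearMap.congr_fun key x
  · ext h
    rw [Module.End.mul_apply]
    simp only [LinearMap.comp_apply]
    rw [sliceRight_comul_sliceRight_comul, dualConv_normalizedRegularCharacter]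
  · ext h
    simp only [Module.End.mul_apply, LinearMap.comp_apply]
    rw [comul_antipode_sq, sliceRight_map, I.normalizedRegularCharacter_antipode_sq]
    rfl
  · intro h
    apply I.ne_zero
    rw [← mul_one Lam, h, mul_zero, map_zero]
  · simp
  · exact right_ne_zero_of_mul_eq_one I.trace_antipode_sq
  · have h₂ := I.trace_antipode_sq_comp e₀
    rw [I.normalizedRegularCharacter_integral] at h₂
    refine mul_left_cancel₀ I.ne_zero ?_
    rw [I.trace_antipode_sq, mul_left_comm, Module.End.mul_eq_comp, h₂, mul_inv_cancel₀ h₁]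

theorem map_mul_comm [CharZero k] (a b : H) : lam (a * b) = lam (b * a) := by
  rw [I.map_mul, I.antipode_sq]

theorem integral_value [CharZero k] : lam Lam = (Module.finrank k H : k)⁻¹ := by
  have h := I.trace_antipode_sq
  have : (antipode k ∘ₗ antipode k : Module.End k H) = LinearMap.id := LinearMap.ext I.antipode_sq
  rw [this, LinearMap.trace_id] at h
  exact eq_inv_of_mul_eq_one_left h

/-- As lam(Λ) = 1/dim H, the trace formula for multiplication by h reads Σ lam(Λ₂hS(Λ₁)) = Σ
lam(hS(Λ₁)Λ₂) = lam(h). -/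
theorem eq_normalizedRegularCharacter [CharZero k] : normalizedRegularCharacter k H = lam := by
  ext h
  have h₁ := I.trace_eq (LinearMap.mul k H h) (ℛ k Lam)
  simp only [LinearMap.mul_apply_apply] at h₁
  rw [Finset.sum_congr rfl fun i _ => I.map_mul_comm _ _] at h₁
  simp only [mul_assoc] at h₁
  rw [← map_sum, ← Finset.mul_sum, sum_antipode_mul_eq_smul, I.counit_eq_one, one_smul,
    mul_one, I.integral_value] at h₁
  exact h₁

end IsIntegralPair

end RegularCharacter

/-! ### Normalized integrals in a semisimple Hopf algebra -/

section Semisimple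

variable {k : Type u} [Field k] {H : Type v} [Ring H] [HopfAlgebra k H]

/-- Choose a left ideal L complementary to ker ε and let Λ be the L-component of 1. Then (h - ε(h))Λ
lies in both ker ε and L. -/
theorem exists_left_integral [IsSemisimpleRing H] :
    ∃ Lam : H, (∀ h : H, h * Lam = counit (R := k) h • Lam) ∧ counit (R := k) Lam = 1 := by
  let K : Submodule H H := RingHom.ker (Bialgebra.counitAlgHom k H).toRingHom
  obtain ⟨L, hL⟩ := exists_isCompl K
  obtain ⟨a, ha, Lam, hLam, h₁⟩ := Submodule.mem_sup.1
    (hL.sup_eq_top ▸ Submodule.mem_top : (1 : H) ∈ K ⊔ L)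
  have hK : ∀ x, x ∈ K ↔ counit (R := k) x = 0 := fun x => RingHom.mem_ker
  have hε : counit (R := k) Lam = 1 := by
    have := congrArg (counit (R := k)) h₁
    rwa [map_add, (hK a).1 ha, zero_add, Bialgebra.counit_one] at this
  refine ⟨Lam, fun h => ?_, hε⟩
  have h₂ : (h - algebraMap k H (counit (R := k) h)) • Lam ∈ K ⊓ L := by
    refine ⟨?_, L.smul_mem _ hLam⟩
    rw [SetLike.mem_coe, hK, smul_eq_mul, Bialgebra.counit_mul, map_sub,
      Bialgebra.counit_algebraMap, sub_self, zero_mul]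
  rw [hL.inf_eq_bot, Submodule.mem_bot, smul_eq_mul, sub_mul, sub_eq_zero] at h₂
  rw [h₂, Algebra.smul_def]

theorem exists_right_integral [IsSemisimpleRing H] :
    ∃ Lam : H, (∀ h : H, Lam * h = counit (R := k) h • Lam) ∧ counit (R := k) Lam = 1 := by
  let c : Hᵐᵒᵖ →+* k := (Bialgebra.counitAlgHom k H).toRingHom.fromOpposite
    fun _ _ => Commute.all _ _
  let K : Submodule Hᵐᵒᵖ Hᵐᵒᵖ := RingHom.ker c
  obtain ⟨L, hL⟩ := exists_isCompl K
  obtain ⟨a, ha, Lam, hLam, h₁⟩ := Submodule.mem_sup.1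
    (hL.sup_eq_top ▸ Submodule.mem_top : (1 : Hᵐᵒᵖ) ∈ K ⊔ L)
  have hK : ∀ x, x ∈ K ↔ c x = 0 := fun x => RingHom.mem_ker
  have hε : c Lam = 1 := by
    have := congrArg c h₁
    rwa [map_add, (hK a).1 ha, zero_add, map_one] at this
  refine ⟨Lam.unop, fun h => ?_, hε⟩
  have h₂ : (MulOpposite.op (h - algebraMap k H (counit (R := k) h))) • Lam ∈ K ⊓ L := by
    refine ⟨?_, L.smul_mem _ hLam⟩
    rw [SetLike.mem_coe, hK, smul_eq_mul, map_mul]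
    have : c (MulOpposite.op (h - algebraMap k H (counit (R := k) h))) = 0 := by
      change counit (R := k) (h - algebraMap k H (counit (R := k) h)) = 0
      rw [map_sub, Bialgebra.counit_algebraMap, sub_self]
    rw [this, zero_mul]
  rw [hL.inf_eq_bot, Submodule.mem_bot, smul_eq_mul] at h₂
  have h₃ := congrArg MulOpposite.unop h₂
  rw [MulOpposite.unop_mul, MulOpposite.unop_op, MulOpposite.unop_zero, mul_sub, sub_eq_zero]
    at h₃
  rw [h₃, Algebra.smul_def, Algebra.commutes]

theorem exists_integral [IsSemisimpleRing H] :
    ∃ Lam : H, (∀ h : H, h * Lam = counit (R := k) h • Lam) ∧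
      (∀ h : H, Lam * h = counit (R := k) h • Lam) ∧ counit (R := k) Lam = 1 := by
  obtain ⟨x, hx, hx'⟩ := exists_left_integral (k := k) (H := H)
  obtain ⟨y, hy, hy'⟩ := exists_right_integral (k := k) (H := H)
  have : y = x := by
    have h₁ := hx y
    rw [hy, hx', hy', one_smul, one_smul] at h₁
    exact h₁
  subst this
  exact ⟨y, hx, hy, hy'⟩

end Semisimple

/-! ### The Drinfeld map of a quasitriangular Hopf algebra -/

section Quasitriangular

variable {k : Type u} [Field k] {H : Type v} [Ring H] [HopfAlgebra k H] {R : H ⊗[k] H}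

@[simp] theorem switch_tmul (a b : H) : switch (a ⊗ₜ[k] b) = b ⊗ₜ a := rfl

theorem switch_switch (x : H ⊗[k] H) : switch (switch x) = x := by
  induction x with
  | zero => simp
  | add x y hx hy => rw [map_add, map_add, hx, hy]
  | tmul a b => rfl

theorem drinfeldMap_apply (R : H ⊗[k] H) (f : Module.Dual k H) :
    drinfeldMap R f = sliceRight f (switch R * R) := rfl

/-- The image of Φ lies in the span of the finitely many first legs of an expression of b. -/
theorem finite_of_drinfeldMap_surjective (hR : Function.Surjective (drinfeldMap R)) :
    Module.Finite k H := by
  obtain ⟨s, hs⟩ := TensorProduct.exists_finset (switch R * R)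
  classical
  refine ⟨⟨s.image Prod.fst, ?_⟩⟩
  rw [eq_top_iff]
  rintro x -
  obtain ⟨f, rfl⟩ := hR x
  rw [drinfeldMap_apply, hs, map_sum]
  refine Submodule.sum_mem _ fun i hi => ?_
  rw [sliceRight_tmul]
  exact Submodule.smul_mem _ _ (Submodule.subset_span (Finset.mem_coe.2
    (Finset.mem_image_of_mem _ hi)))

theorem sliceLeft_counit_mul (x y : H ⊗[k] H) :
    sliceLeft (counit (R := k)) (x * y) =
      sliceLeft (counit (R := k)) x * sliceLeft (counit (R := k)) y := by
  induction x with
  | zero => simp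
  | add x x' hx hx' => rw [add_mul, map_add, map_add, hx, hx', add_mul]
  | tmul a b =>
    induction y with
    | zero => simp
    | add y y' hy hy' => rw [mul_add, map_add, map_add, hy, hy', mul_add]
    | tmul c d => simp [mul_smul, smul_comm (counit (R := k) a)]

theorem sliceLeft_switch (f : Module.Dual k H) (x : H ⊗[k] H) :
    sliceLeft f (switch x) = sliceRight f x := by
  induction x with
  | zero => simp
  | add x y hx hy => rw [map_add, map_add, map_add, hx, hy]
  | tmul a b => simp

namespace IsQuasitriangular

variable (hR : IsQuasitriangular R)
include hR

/-- Applying ε to the first leg of (Δ ⊗ id)(R) = R₁₃R₂₃ gives R = (1 ⊗ (ε ⊗ id)(R))R, and R cancels.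
-/
theorem sliceLeft_counit : sliceLeft (counit (R := k)) R = 1 := by
  let E : H ⊗[k] (H ⊗[k] H) →ₐ[k] H ⊗[k] H :=
    (Algebra.TensorProduct.lid k (H ⊗[k] H)).toAlgHom.comp
      (Algebra.TensorProduct.map (Bialgebra.counitAlgHom k H) (AlgHom.id k _))
  have hE : ∀ (a : H) (y : H ⊗[k] H), E (a ⊗ₜ y) = counit (R := k) a • y := fun a y => rfl
  have h₁ : ∀ x, E (TensorProduct.assoc k H H H ((comul (R := k) (A := H)).rTensor H x)) = x := by
    intro x
    induction x with
    | zero => simp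
    | add x y hx hy => rw [map_add, map_add, map_add, hx, hy]
    | tmul a b =>
      rw [LinearMap.rTensor_tmul]
      have h₂ : ∀ z : H ⊗[k] H, E (TensorProduct.assoc k H H H (z ⊗ₜ b)) =
          sliceLeft (counit (R := k)) z ⊗ₜ b := by
        intro z
        induction z with
        | zero => simp
        | add x y hx hy => rw [add_tmul, map_add, map_add, map_add, hx, hy, add_tmul]
        | tmul p q => simp [hE, smul_tmul']
      rw [h₂]
      congr 1
      have h₃ : ∀ z : H ⊗[k] H, sliceLeft (counit (R := k)) z =
          TensorProduct.lid k H ((counit (R := k)).rTensor H z) := by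
        intro z
        induction z with
        | zero => simp
        | add x y hx hy => simp only [map_add, hx, hy]
        | tmul p q => simp
      rw [h₃, rTensor_counit_comul, TensorProduct.lid_tmul, one_smul]
  have h₂ : ∀ x, E (leg₁₃ x) = 1 ⊗ₜ sliceLeft (counit (R := k)) x := by
    intro x
    induction x with
    | zero => simp
    | add x y hx hy => rw [map_add, map_add, map_add, hx, hy, tmul_add]
    | tmul a b => simp [leg₁₃, hE]
  have h₃ : ∀ x, E (leg₂₃ x) = x := by
    intro x
    simp [leg₂₃, hE]
  have h := congrArg E hR.comul_left
  rw [h₁, map_mul, h₂, h₃] at h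
  have h₄ : (1 : H) ⊗ₜ[k] sliceLeft (counit (R := k)) R = 1 :=
    hR.isUnit.mul_right_cancel (by rw [← h, one_mul])
  have := congrArg (sliceLeft (counit (R := k))) h₄
  simpa [Algebra.TensorProduct.one_def] using this

theorem sliceRight_counit : sliceRight (counit (R := k)) R = 1 := by
  let E : H ⊗[k] (H ⊗[k] H) →ₐ[k] H ⊗[k] H :=
    Algebra.TensorProduct.map (AlgHom.id k H) ((Algebra.TensorProduct.rid k k H).toAlgHom.comp
      (Algebra.TensorProduct.map (AlgHom.id k H) (Bialgebra.counitAlgHom k H)))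
  have hE : ∀ a b c : H, E (a ⊗ₜ (b ⊗ₜ c)) = a ⊗ₜ (counit (R := k) c • b) := fun a b c => rfl
  have h₁ : ∀ x, E ((comul (R := k) (A := H)).lTensor H x) = x := by
    intro x
    induction x with
    | zero => simp
    | add x y hx hy => rw [map_add, map_add, hx, hy]
    | tmul a b =>
      rw [LinearMap.lTensor_tmul]
      have h₂ : ∀ z : H ⊗[k] H, E (a ⊗ₜ z) = a ⊗ₜ sliceRight (counit (R := k)) z := by
        intro z
        induction z with
        | zero => simp
        | add x y hx hy => rw [tmul_add, map_add, map_add, hx, hy, tmul_add]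
        | tmul p q => simp [hE]
      rw [h₂, sliceRight_comul_counit]
  have h₂ : ∀ x, E (leg₁₃ x) = sliceRight (counit (R := k)) x ⊗ₜ 1 := by
    intro x
    induction x with
    | zero => simp
    | add x y hx hy => rw [map_add, map_add, map_add, hx, hy, add_tmul]
    | tmul a b => simp [leg₁₃, hE, smul_tmul]
  have h₃ : ∀ x, E (leg₁₂ x) = x := by
    intro x
    induction x with
    | zero => simp
    | add x y hx hy => rw [map_add, map_add, hx, hy]
    | tmul a b => simp [leg₁₂, hE]
  have h := congrArg E hR.comul_right
  rw [h₁, map_mul, h₂, h₃] at h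
  have h₄ : sliceRight (counit (R := k)) R ⊗ₜ[k] (1 : H) = 1 :=
    hR.isUnit.mul_right_cancel (by rw [← h, one_mul])
  have := congrArg (sliceRight (counit (R := k))) h₄
  simpa [Algebra.TensorProduct.one_def] using this

theorem counit_drinfeldMap (f : Module.Dual k H) :
    counit (R := k) (drinfeldMap R f) = f 1 := by
  rw [drinfeldMap_apply, apply_sliceRight, sliceLeft_counit_mul, sliceLeft_switch,
    hR.sliceRight_counit, hR.sliceLeft_counit, one_mul]

theorem switch_mul_comm (h : H) :
    switch R * R * comul (R := k) h = comul (R := k) h * (switch R * R) := by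
  have := congrArg switch (hR.almost_cocommutative h)
  rw [map_mul, map_mul, switch_switch] at this
  rw [mul_assoc, ← hR.almost_cocommutative, ← mul_assoc, ← this, mul_assoc]

/-- The coproduct in the second leg of `b = τ(R) R`. -/
theorem lTensor_comul :
    (comul (R := k) (A := H)).lTensor H (switch R * R) =
      leg₁₂ (switch R) * leg₁₃ (switch R * R) * leg₁₂ R := by
  -- The cyclic permutation a ⊗ b ⊗ c ↦ c ⊗ a ⊗ b turns (Δ ⊗ id)(R) = R₁₃R₂₃ into (id ⊗ Δ)(τR) =
  -- (τR)₁₂(τR)₁₃.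
  let C : H ⊗[k] (H ⊗[k] H) →ₐ[k] H ⊗[k] (H ⊗[k] H) :=
    (Algebra.TensorProduct.comm k (H ⊗[k] H) H).toAlgHom.comp
      (Algebra.TensorProduct.assoc k k k H H H).symm.toAlgHom
  have hC : ∀ a b c : H, C (a ⊗ₜ (b ⊗ₜ c)) = c ⊗ₜ (a ⊗ₜ b) := fun a b c => rfl
  have h₁ : ∀ x, C (TensorProduct.assoc k H H H ((comul (R := k) (A := H)).rTensor H x)) =
      (comul (R := k) (A := H)).lTensor H (switch x) := by
    intro x
    induction x with
    | zero => simp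
    | add x y hx hy => simp only [map_add, hx, hy]
    | tmul a b =>
      rw [switch_tmul, LinearMap.lTensor_tmul, LinearMap.rTensor_tmul]
      generalize comul (R := k) a = z
      induction z with
      | zero => simp
      | add x y hx hy => rw [add_tmul, map_add, map_add, hx, hy, tmul_add]
      | tmul p q => rfl
  have h₂ : ∀ x, C (leg₁₃ x) = leg₁₂ (switch x) := by
    intro x
    induction x with
    | zero => simp
    | add x y hx hy => simp only [map_add, hx, hy]
    | tmul a b => rfl
  have h₃ : ∀ x, C (leg₂₃ x) = leg₁₃ (switch x) := by
    intro x
    induction x with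
    | zero => simp
    | add x y hx hy => simp only [map_add, hx, hy]
    | tmul a b => rfl
  have h := congrArg C hR.comul_left
  rw [h₁, map_mul, h₂, h₃] at h
  have h₄ : ∀ x y : H ⊗[k] H, (comul (R := k) (A := H)).lTensor H (x * y) =
      (comul (R := k) (A := H)).lTensor H x * (comul (R := k) (A := H)).lTensor H y := fun x y =>
    map_mul (Algebra.TensorProduct.map (AlgHom.id k H) (Bialgebra.comulAlgHom k H)) x y
  rw [h₄, h, hR.comul_right, map_mul]
  simp only [mul_assoc]

/-- The Drinfeld map reverses convolution products whose second factor has a central image. -/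
theorem drinfeldMap_dualConv (f g : Module.Dual k H)
    (hg : ∀ h, drinfeldMap R g * h = h * drinfeldMap R g) :
    drinfeldMap R (dualConv f g) = drinfeldMap R g * drinfeldMap R f := by
  have h₁ : ∀ x : H ⊗[k] H, sliceRight (dualConv f g) x = sliceRight f
      ((sliceRight g).lTensor H ((comul (R := k) (A := H)).lTensor H x)) := by
    intro x
    induction x with
    | zero => simp
    | add x y hx hy => simp only [map_add, hx, hy]
    | tmul a b => simp [dualConv]
  have h₂ : ∀ x y : H ⊗[k] H, ∀ z, (sliceRight g).lTensor H (leg₁₂ x * z * leg₁₂ y) =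
      x * (sliceRight g).lTensor H z * y := by
    intro x y z
    induction x with
    | zero => simp
    | add x x' hx hx' => simp only [map_add, add_mul, hx, hx']
    | tmul a b =>
      induction y with
      | zero => simp
      | add y y' hy hy' => simp only [map_add, mul_add, hy, hy']
      | tmul c d =>
        induction z with
        | zero => simp
        | add z z' hz hz' => simp only [map_add, mul_add, add_mul, hz, hz']
        | tmul p q =>
          simp [leg₁₂, sliceRight_mul_tmul_one, sliceRight_tmul_one_mul]
  have h₃ : ∀ x : H ⊗[k] H, (sliceRight g).lTensor H (leg₁₃ x) = sliceRight g x ⊗ₜ 1 := by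
    intro x
    induction x with
    | zero => simp
    | add x y hx hy => simp only [map_add, hx, hy, add_tmul]
    | tmul a b => simp [leg₁₃, smul_tmul]
  have h₄ : ∀ x : H ⊗[k] H, x * (drinfeldMap R g ⊗ₜ 1) = (drinfeldMap R g ⊗ₜ 1) * x := by
    intro x
    induction x with
    | zero => simp
    | add x y hx hy => simp only [add_mul, mul_add, hx, hy]
    | tmul a b => simp [hg]
  -- Contracting the third leg with g leaves τ(R)(Φ(g) ⊗ 1)R; centrality of Φ(g) moves it out to the
  -- left.
  rw [drinfeldMap_apply, h₁, hR.lTensor_comul, h₂, h₃, ← drinfeldMap_apply, h₄, mul_assoc,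
    sliceRight_tmul_one_mul, drinfeldMap_apply R f]

/-- The element h ⊗ 1 equals Σ Δ(h₁)(1 ⊗ S(h₂)) and, since S² = 1, also Σ (1 ⊗ S(h₂))Δ(h₁). As b
commutes with Δ(h₁) and f is a trace, multiplying b by h ⊗ 1 on either side gives the same slice. -/
theorem drinfeldMap_mul_comm_of_trace (hS : ∀ x : H, antipode k (antipode k x) = x)
    {f : Module.Dual k H} (hf : ∀ a b, f (a * b) = f (b * a)) (h : H) :
    drinfeldMap R f * h = h * drinfeldMap R f := by
  have h₁ : ∑ i ∈ (ℛ k h).index, ((1 : H) ⊗ₜ[k] antipode k ((ℛ k h).right i)) *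
      comul (R := k) ((ℛ k h).left i) = h ⊗ₜ 1 := by
    have h₂ : ∀ (y : H ⊗[k] H) (a : H), (antipode k).lTensor H
        ((antipode k).lTensor H y * (1 ⊗ₜ a)) = (1 ⊗ₜ antipode k a) * y := by
      intro y a
      induction y with
      | zero => simp
      | add x y hx hy => simp only [map_add, add_mul, mul_add, hx, hy]
      | tmul p q => simp [antipode_mul_antidistrib, hS]
    have := congrArg ((antipode k).lTensor H) (sum_antipode_comul_mul_one_tmul (ℛ k h))
    simpa [map_sum, h₂] using this
  rw [drinfeldMap_apply, ← sliceRight_mul_tmul_one, ← sum_comul_mul_one_tmul_antipode (ℛ k h),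
    Finset.mul_sum, map_sum]
  rw [← sliceRight_tmul_one_mul, ← h₁, Finset.sum_mul, map_sum]
  refine Finset.sum_congr rfl fun i _ => ?_
  rw [← mul_assoc, sliceRight_mul_comm_of_trace hf, hR.switch_mul_comm, mul_assoc]

end IsQuasitriangular

theorem trace_pairing_mul_comm {f g : Module.Dual k H} (hf : ∀ a b, f (a * b) = f (b * a))
    (hg : ∀ a b, g (a * b) = g (b * a)) (x y : H ⊗[k] H) :
    g (sliceRight f (x * y)) = g (sliceRight f (y * x)) := by
  induction x with
  | zero => simp
  | add x x' hx hx' => simp only [map_add, add_mul, mul_add, hx, hx']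
  | tmul a b =>
    induction y with
    | zero => simp
    | add y y' hy hy' => simp only [map_add, add_mul, mul_add, hy, hy']
    | tmul c d => simp [hf b d, hg a c]

/-- The flip of b = τ(R)R is Rτ(R), which a pair of trace forms cannot distinguish from b. -/
theorem apply_drinfeldMap_comm {f g : Module.Dual k H} (hf : ∀ a b, f (a * b) = f (b * a))
    (hg : ∀ a b, g (a * b) = g (b * a)) (R : H ⊗[k] H) :
    f (drinfeldMap R g) = g (drinfeldMap R f) := by
  have h := sliceLeft_switch f (R * switch R)
  rw [map_mul, switch_switch] at h
  rw [drinfeldMap_apply, apply_sliceRight, h, trace_pairing_mul_comm hf hg, drinfeldMap_apply]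

end Quasitriangular

/-! ### Integrals, class functions and the center in the factorizable case -/

section Factorizable

theorem surjective_of_injective_of_injective {k : Type u} [Field k] {V : Type v} {W : Type w}
    [AddCommGroup V] [AddCommGroup W] [Module k V] [Module k W] [Module.Finite k V]
    [Module.Finite k W] {f : V →ₗ[k] W} {g : W →ₗ[k] V} (hf : Function.Injective f)
    (hg : Function.Injective g) : Function.Surjective f :=
  (LinearMap.injective_iff_surjective_of_finrank_eq_finrank
    (le_antisymm (LinearMap.finrank_le_finrank_of_injective hf)
      (LinearMap.finrank_le_finrank_of_injective hg))).1 hf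

variable {k : Type u} [Field k] {H : Type v} [Ring H] [HopfAlgebra k H] {R : H ⊗[k] H}

theorem IsFactorizable.exists_integralPair [IsSemisimpleRing H] (hR : IsFactorizable R) :
    ∃ (lam : Module.Dual k H) (Lam : H), IsIntegralPair lam Lam ∧ drinfeldMap R lam = Lam := by
  obtain ⟨Lam, hl, hr, hε⟩ := exists_integral (k := k) (H := H)
  obtain ⟨lam, h⟩ := hR.bijective.2 Lam
  have hQ := hR.quasitriangular
  refine ⟨lam, Lam, ⟨hl, hr, hε, fun x => ?_, ?_⟩, h⟩
  · rw [← sub_eq_zero, ← Module.forall_dual_apply_eq_zero_iff k]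
    intro f
    rw [map_sub, sub_eq_zero]
    -- Φ(f * lam) = ΛΦ(f) = ε(Φ(f))Λ = f(1)Φ(lam), so injectivity of Φ gives f * lam = f(1) lam for
    -- every f.
    have h₁ := hQ.drinfeldMap_dualConv f lam fun y => by rw [h, hl, hr]
    rw [h, hr, hQ.counit_drinfeldMap, ← h, ← map_smul] at h₁
    have h₂ := LinearMap.congr_fun (hR.bijective.1 h₁) x
    rw [map_smul, smul_eq_mul, mul_comm]
    exact h₂
  · rw [← hQ.counit_drinfeldMap, h, hε]

variable (k H) in
/-- The class functions on `H`: the linear forms vanishing on commutators. -/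
def classFunctions : Submodule k (Module.Dual k H) where
  carrier := {f | ∀ a b, f (a * b) = f (b * a)}
  zero_mem' := fun _ _ => rfl
  add_mem' := fun hf hg a b => by simp [hf a b, hg a b]
  smul_mem' := fun c f hf a b => by simp [hf a b]

/-- A dimension count: Φ embeds the class functions in the center, and z ↦ lam(z ·) embeds the
center in the class functions. -/
theorem IsFactorizable.exists_classFunction [CharZero k] [IsSemisimpleRing H]
    (hR : IsFactorizable R) {z : H} (hz : z ∈ Subalgebra.center k H) :
    ∃ f ∈ classFunctions k H, drinfeldMap R f = z := by
  have := finite_of_drinfeldMap_surjective hR.bijective.2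
  obtain ⟨lam, Lam, I, -⟩ := hR.exists_integralPair
  let Z := Subalgebra.toSubmodule (Subalgebra.center k H)
  have hZ : ∀ x, x ∈ Z ↔ ∀ y, y * x = x * y := fun x => Subalgebra.mem_center_iff (R := k)
  let Φ : classFunctions k H →ₗ[k] Z := (drinfeldMap R ∘ₗ (classFunctions k H).subtype).codRestrict
    Z fun f => (hZ _).2 fun y =>
      (hR.quasitriangular.drinfeldMap_mul_comm_of_trace I.antipode_sq f.2 y).symm
  let F : Z →ₗ[k] classFunctions k H :=
    ((LinearMap.mul k H).compr₂ lam ∘ₗ Z.subtype).codRestrict _ fun z a b => by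
      change lam (z * (a * b)) = lam (z * (b * a))
      rw [← mul_assoc, ← (hZ z).1 z.2 a, mul_assoc, I.map_mul_comm, mul_assoc]
  have hF : Function.Injective F := by
    refine (injective_iff_map_eq_zero F).2 fun z hz => ?_
    refine Subtype.ext (I.eq_zero_of_forall fun y => ?_)
    rw [(hZ z).1 z.2]
    exact LinearMap.congr_fun (congrArg Subtype.val hz) y
  have hΦ : Function.Injective Φ := fun f g hfg =>
    Subtype.ext (hR.bijective.1 (congrArg Subtype.val hfg))
  have hs := surjective_of_injective_of_injective (k := k) (V := classFunctions k H) (W := Z)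
    (f := Φ) (g := F) hΦ hF
  obtain ⟨f, hf⟩ := hs ⟨z, hz⟩
  exact ⟨f, f.2, congrArg Subtype.val hf⟩

/-- The integral of the dual restricts to a nondegenerate form on the center. -/
theorem IsIntegralPair.eq_zero_of_forall_center [CharZero k] [Module.Finite k H]
    {lam : Module.Dual k H} {Lam : H} (I : IsIntegralPair lam Lam) {z : H}
    (hz : z ∈ Subalgebra.center k H)
    (h : ∀ c ∈ Subalgebra.center k H, lam (c * z) = 0) : z = 0 := by
  have hz' : ∀ y, y * z = z * y := (Subalgebra.mem_center_iff (R := k)).1 hz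
  refine I.eq_zero_of_forall fun y => ?_
  -- Averaging: by the Casimir property S(Λ₁)yΛ₂ is central. Its pairing with z is lam(yzΛ₂S(Λ₁)) =
  -- lam(yz), where Λ₂S(Λ₁) = 1 uses S² = 1.
  let A : H ⊗[k] H →ₗ[k] H := LinearMap.mul' k H ∘ₗ (LinearMap.mulRight k y).rTensor H
  have hA : ∀ a b, A (a ⊗ₜ b) = a * y * b := fun a b => rfl
  have hA₁ : ∀ a x, A ((a ⊗ₜ 1) * x) = a * A x := by
    intro a x
    induction x with
    | zero => simp
    | add x x' hx hx' => simp only [map_add, mul_add, hx, hx']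
    | tmul p q => simp [hA, mul_assoc]
  have hA₂ : ∀ a x, A (x * (1 ⊗ₜ a)) = A x * a := by
    intro a x
    induction x with
    | zero => simp
    | add x x' hx hx' => simp only [map_add, add_mul, hx, hx']
    | tmul p q => simp [hA, mul_assoc]
  have h₁ := h (A ((antipode k).rTensor H (comul (R := k) Lam))) <|
    (Subalgebra.mem_center_iff (R := k)).2 fun a => by rw [← hA₁, I.casimir, hA₂]
  rw [← (ℛ k Lam).eq] at h₁
  simp only [map_sum, LinearMap.rTensor_tmul, hA, Finset.sum_mul] at h₁
  have h₂ : ∀ a b : H, lam (a * y * b * z) = lam (y * z * (b * a)) := by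
    intro a b
    rw [mul_assoc, mul_assoc, I.map_mul_comm, hz' b, mul_assoc, mul_assoc, mul_assoc]
  simp only [h₂] at h₁
  have h₃ : ∑ i ∈ (ℛ k Lam).index, (ℛ k Lam).right i * antipode k ((ℛ k Lam).left i) =
      (1 : H) := by
    have := congrArg (antipode k) (sum_mul_antipode_eq_smul (R := k) (ℛ k Lam))
    simpa [map_sum, antipode_mul_antidistrib, I.antipode_sq, I.counit_eq_one] using this
  rwa [← map_sum, ← Finset.mul_sum, h₃, mul_one] at h₁

end Factorizable

/-! ### Generators of the representation ring and their characters -/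

section RepRing

variable {k : Type u} [Field k] {H : Type v} [Ring H] [Bialgebra k H]

theorem RepRing.of_iso {X Y : FinRep k H} (h : FinRep.Iso X Y) :
    RepRing.of X = RepRing.of Y := by
  have : isoClass X = isoClass Y := Quotient.sound h
  rw [RepRing.of, this, RepRing.of]

theorem RepRing.of_directSum (X Y : FinRep k H) :
    RepRing.of (X.directSum Y) = RepRing.of X + RepRing.of Y := by
  unfold RepRing.of
  rw [← map_add]
  refine Quotient.sound ?_
  change _ - _ ∈ directSumRelations k H
  rw [← sub_sub]
  exact relation_mem X Y

theorem RepRing.of_tensor (X Y : FinRep k H) :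
    RepRing.of (X.tensor Y) = RepRing.of X * RepRing.of Y := by
  unfold RepRing.of
  rw [← map_mul, FreeAbelianGroup.of_mul_of]
  rfl

theorem RepRing.of_trivial : RepRing.of (FinRep.trivial k H) = 1 :=
  map_one (directSumIdeal k H).ringCon.mk'

/-- For the zero space X ⊕ X ≅ X, so 2[X] = [X]. -/
theorem RepRing.of_eq_zero {X : FinRep k H} [Subsingleton X.V] : RepRing.of X = 0 := by
  have h : FinRep.Iso (X.directSum X) X :=
    ⟨{ toFun := Prod.fst
       map_add' := fun _ _ => rfl
       map_smul' := fun _ _ => rfl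
       invFun := fun x => (x, x)
       left_inv := fun x => Prod.ext rfl (Subsingleton.elim _ _)
       right_inv := fun _ => rfl }, fun _ _ => rfl⟩
  have := RepRing.of_iso h
  rw [RepRing.of_directSum] at this
  simpa using this

theorem RepRing.closure_range_of :
    AddSubgroup.closure (Set.range (RepRing.of : FinRep k H → RepRing k H)) = ⊤ := by
  rw [eq_top_iff]
  rintro x -
  obtain ⟨a, rfl⟩ := (directSumIdeal k H).ringCon.mk'_surjective x
  induction a using FreeAbelianGroup.induction_on with
  | zero => rw [map_zero]; exact zero_mem _
  | add x y hx hy => rw [map_add]; exact add_mem hx hy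
  | neg x hx => rw [map_neg]; exact neg_mem hx
  | of x =>
    induction x using Quotient.inductionOn with
    | h X => exact AddSubgroup.subset_closure ⟨X, rfl⟩

/-- A set of additive generators of `R(H)` generates `R_k(H)` as a vector space. -/
theorem RepAlgebra.span_eq_top {s : Set (RepRing k H)} (hs : AddSubgroup.closure s = ⊤) :
    Submodule.span k ((fun x => (1 : k) ⊗ₜ[ℤ] x) '' s) = (⊤ : Submodule k (RepAlgebra k H)) := by
  rw [eq_top_iff]
  rintro x -
  induction x with
  | zero => exact zero_mem _
  | add x y hx hy => exact add_mem hx hy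
  | tmul c x =>
    have hx : x ∈ AddSubgroup.closure s := hs ▸ AddSubgroup.mem_top x
    have : c ⊗ₜ[ℤ] x = c • ((1 : k) ⊗ₜ[ℤ] x) := by rw [smul_tmul', smul_eq_mul, mul_one]
    rw [this]
    clear this
    refine Submodule.smul_mem _ _ ?_
    induction hx using AddSubgroup.closure_induction with
    | mem x hx => exact Submodule.subset_span ⟨x, hx, rfl⟩
    | zero => rw [tmul_zero]; exact zero_mem _
    | add x y _ _ hx hy => rw [tmul_add]; exact add_mem hx hy
    | neg x _ hx => rw [tmul_neg]; exact neg_mem hx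

theorem RepAlgebra.span_of :
    Submodule.span k (Set.range fun X : FinRep k H => (1 : k) ⊗ₜ[ℤ] RepRing.of X) =
      (⊤ : Submodule k (RepAlgebra k H)) := by
  rw [← RepAlgebra.span_eq_top RepRing.closure_range_of, ← Set.range_comp]
  rfl

theorem characterMap_of (X : FinRep k H) :
    characterMap k H ((1 : k) ⊗ₜ[ℤ] RepRing.of X) = X.character := by
  have : RepRing.lift FinRep.character (fun _ _ => FinRep.character_iso)
      FinRep.character_directSum (RepRing.of X) = X.character :=
    FreeAbelianGroup.lift_apply_of _ _
  rw [characterMap, LinearMap.liftBaseChange_tmul, one_smul]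
  exact this

theorem invariantsForm_of (X : FinRep k H) :
    invariantsForm k H ((1 : k) ⊗ₜ[ℤ] RepRing.of X) = Module.finrank k X.invariants := by
  rw [invariantsForm, LinearMap.liftBaseChange_tmul, one_smul]
  exact FreeAbelianGroup.lift_apply_of _ _

theorem FinRep.trace_act₂ (X Y : FinRep k H) (y : H ⊗[k] H) :
    LinearMap.trace k _ (X.act₂ Y y) = X.character (sliceRight Y.character y) := by
  induction y with
  | zero => simp
  | add x y hx hy => rw [map_add, map_add, hx, hy, map_add, map_add]
  | tmul a b =>
    have : X.act₂ Y (a ⊗ₜ b) = TensorProduct.map (X.ρ a) (Y.ρ b) := rfl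
    rw [this, LinearMap.trace_tensorProduct', sliceRight_tmul, map_smul, smul_eq_mul, mul_comm]
    rfl

theorem FinRep.character_tensor (X Y : FinRep k H) :
    (X.tensor Y).character = dualConv X.character Y.character :=
  LinearMap.ext fun h => FinRep.trace_act₂ X Y (comul (R := k) h)

theorem FinRep.character_trivial : (FinRep.trivial k H).character = counit (R := k) := by
  ext h
  have : (FinRep.trivial k H).ρ h =
      (counit (R := k) h • LinearMap.id : Module.End k k) :=
    LinearMap.ext fun c : k => FinRep.trivial_ρ h c
  change LinearMap.trace k k ((FinRep.trivial k H).ρ h) = _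
  rw [this, map_smul, LinearMap.trace_id, Module.finrank_self, Nat.cast_one, smul_eq_mul, mul_one]

theorem FinRep.character_mem (X : FinRep k H) (a b : H) :
    X.character (a * b) = X.character (b * a) := by
  change LinearMap.trace k X.V (X.ρ (a * b)) = LinearMap.trace k X.V (X.ρ (b * a))
  rw [map_mul X.ρ, map_mul X.ρ, LinearMap.trace_mul_comm]

/-- The value of a character at a normalized integral is the dimension of the invariants. -/
theorem FinRep.character_integral (X : FinRep k H) {Lam : H}
    (hl : ∀ h : H, h * Lam = counit (R := k) h • Lam) (hε : counit (R := k) Lam = 1) :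
    X.character Lam = Module.finrank k X.invariants := by
  have : LinearMap.IsProj X.invariants (X.ρ Lam) :=
    ⟨fun x h => by
      rw [← Module.End.mul_apply, ← map_mul, hl, map_smul, LinearMap.smul_apply],
    fun x hx => by rw [hx Lam, hε, one_smul]⟩
  exact this.trace

end RepRing

/-! ### Matrix units, irreducible representations and class functions -/

section Wedderburn

variable {k : Type u} [Field k] {H : Type v} [Ring H] [Bialgebra k H] {n : ℕ} {d : Fin n → ℕ}

/-- The matrix units of a product of matrix algebras. -/
def matrixUnit (e : H ≃ₐ[k] Π i, Matrix (Fin (d i)) (Fin (d i)) k) (i : Fin n)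
    (a b : Fin (d i)) : H :=
  e.symm (Pi.single i (Matrix.single a b 1))

/-- The irreducible representation afforded by a factor of a product of matrix algebras. -/
def simpleRep (e : H ≃ₐ[k] Π i, Matrix (Fin (d i)) (Fin (d i)) k) (i : Fin n) : FinRep k H where
  V := Fin (d i) → k
  ρ := (Matrix.toLinAlgEquiv' : Matrix (Fin (d i)) (Fin (d i)) k ≃ₐ[k] _).toAlgHom.comp
    ((Pi.evalAlgHom k (fun i => Matrix (Fin (d i)) (Fin (d i)) k) i).comp e.toAlgHom)

variable (e : H ≃ₐ[k] Π i, Matrix (Fin (d i)) (Fin (d i)) k)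

theorem simpleRep_character (i : Fin n) (h : H) :
    (simpleRep e i).character h = (e h i).trace :=
  Matrix.trace_toLin'_eq (e h i)

theorem mul_matrixUnit (h : H) (i : Fin n) (b c : Fin (d i)) :
    h * matrixUnit e i b c = ∑ a, e h i a b • matrixUnit e i a c := by
  apply e.injective
  funext j
  simp only [matrixUnit, map_mul, map_sum, map_smul, AlgEquiv.apply_symm_apply, Pi.mul_apply,
    Finset.sum_apply, Pi.smul_apply]
  obtain rfl | hj := eq_or_ne j i
  · ext p q
    simp [Matrix.mul_apply, Matrix.sum_apply, Matrix.single_apply, ite_and]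
  · simp [hj]

theorem matrixUnit_mul (h : H) (i : Fin n) (c a : Fin (d i)) :
    matrixUnit e i c a * h = ∑ b, e h i a b • matrixUnit e i c b := by
  apply e.injective
  funext j
  simp only [matrixUnit, map_mul, map_sum, map_smul, AlgEquiv.apply_symm_apply, Pi.mul_apply,
    Finset.sum_apply, Pi.smul_apply]
  obtain rfl | hj := eq_or_ne j i
  · ext p q
    simp [Matrix.mul_apply, Matrix.sum_apply, Matrix.single_apply, ite_and]
  · simp [hj]

theorem apply_matrixUnit_same (i : Fin n) (a b : Fin (d i)) :
    e (matrixUnit e i a b) i = Matrix.single a b 1 := by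
  simp [matrixUnit]

theorem apply_matrixUnit_of_ne {i j : Fin n} (h : j ≠ i) (a b : Fin (d i)) :
    e (matrixUnit e i a b) j = 0 := by
  simp [matrixUnit, h]

theorem matrixUnit_mul_matrixUnit (i : Fin n) (a b c c' : Fin (d i)) :
    matrixUnit e i a b * matrixUnit e i c c' = if b = c then matrixUnit e i a c' else 0 := by
  rw [mul_matrixUnit, apply_matrixUnit_same]
  by_cases h : b = c
  · simp [Matrix.single_apply, h]
  · simp [h]

theorem sum_matrixUnit : ∑ i, ∑ a, matrixUnit e i a a = 1 := by
  apply e.injective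
  funext j
  simp only [map_sum, Finset.sum_apply, map_one, Pi.one_apply]
  rw [Finset.sum_eq_single j (fun i _ hi => Finset.sum_eq_zero fun a _ =>
    apply_matrixUnit_of_ne e hi.symm a a) (by simp)]
  simp only [apply_matrixUnit_same]
  ext p q
  simp [Matrix.sum_apply, Matrix.single_apply, Matrix.one_apply, ite_and]


/-- The restriction of a representation to a stable subspace. -/
def FinRep.sub (X : FinRep k H) (K : Submodule k X.V) (hK : ∀ h, ∀ x ∈ K, X.ρ h x ∈ K) :
    FinRep k H where
  V := K
  ρ := AlgHom.ofLinearMap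
    { toFun := fun h => (X.ρ h).restrict (hK h)
      map_add' := fun a b => by ext x; simp
      map_smul' := fun c a => by ext x; simp }
    (by ext x; simp) (fun a b => by ext x; simp)

theorem exists_prod_ker_equiv {V : Type v} {W : Type w} [AddCommGroup V] [AddCommGroup W]
    [Module k V] [Module k W] (ι : W →ₗ[k] V) (π : V →ₗ[k] W) (hπι : ∀ y, π (ι y) = y) :
    ∃ E : (W × LinearMap.ker π) ≃ₗ[k] V, ∀ z, E z = ι z.1 + z.2 := by
  refine ⟨LinearEquiv.ofLinearMap (ι.coprod (LinearMap.ker π).subtype)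
    (π.prod ((LinearMap.id - ι ∘ₗ π).codRestrict (LinearMap.ker π) fun x => ?_)) ?_ ?_,
    fun z => rfl⟩
  · refine LinearMap.ext fun x => ?_
    simp
  · refine LinearMap.ext fun z => ?_
    have := z.2.2
    rw [LinearMap.mem_ker] at this
    refine Prod.ext ?_ (Subtype.ext ?_)
    · simp [hπι]
    · simp [hπι]
  · simp [hπι]

theorem FinRep.iso_directSum_ker {X Y : FinRep k H} (ι : Y.V →ₗ[k] X.V) (π : X.V →ₗ[k] Y.V)
    (hι : ∀ h y, ι (Y.ρ h y) = X.ρ h (ι y)) (hπ : ∀ h x, π (X.ρ h x) = Y.ρ h (π x))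
    (hπι : ∀ y, π (ι y) = y) :
    FinRep.Iso (Y.directSum (X.sub (LinearMap.ker π) fun h x hx => by
      rw [LinearMap.mem_ker] at hx ⊢; rw [hπ, hx, map_zero])) X := by
  obtain ⟨E, hE⟩ := exists_prod_ker_equiv ι π hπι
  refine ⟨E, fun h z => ?_⟩
  have h₁ : X.ρ h (E z) = ι (Y.ρ h z.1) + X.ρ h z.2.1 := by
    rw [hι, ← map_add]
    exact congrArg (X.ρ h) (hE z)
  exact (hE _).trans h₁.symm

variable [∀ i, NeZero (d i)]

/-- A class function on a product of matrix algebras is a combination of irreducible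
characters. -/
theorem eq_sum_character {f : Module.Dual k H} (hf : ∀ a b, f (a * b) = f (b * a)) :
    f = ∑ i, f (matrixUnit e i 0 0) • (simpleRep e i).character := by
  -- From E_ab = E_a0 E_0b and the trace property, f(E_ab) = f(E_0b E_a0).
  have h₁ : ∀ i a b, f (matrixUnit e i a b) = if a = b then f (matrixUnit e i 0 0) else 0 := by
    intro i a b
    have : matrixUnit e i a b = matrixUnit e i a 0 * matrixUnit e i 0 b := by
      rw [matrixUnit_mul_matrixUnit, if_pos rfl]
    rw [this, hf, matrixUnit_mul_matrixUnit]
    by_cases hab : a = b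
    · simp [hab]
    · simp [hab, Ne.symm hab]
  obtain ⟨c, hc⟩ : ∃ c : Fin n → k, ∀ i, f (matrixUnit e i 0 0) = c i := ⟨_, fun _ => rfl⟩
  simp only [hc] at h₁ ⊢
  ext h
  have h₂ : h = ∑ i, ∑ b, ∑ a, e h i a b • matrixUnit e i a b := by
    simp only [← mul_matrixUnit, ← Finset.mul_sum, sum_matrixUnit, mul_one]
  conv_lhs => rw [h₂]
  simp [map_sum, h₁, simpleRep_character, Matrix.trace, Finset.mul_sum, mul_comm]

theorem simpleRep_character_matrixUnit (i j : Fin n) :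
    (simpleRep e i).character (matrixUnit e j 0 0) = if i = j then 1 else 0 := by
  rw [simpleRep_character]
  by_cases h : i = j
  · subst h
    rw [apply_matrixUnit_same, if_pos rfl, Matrix.trace_single_eq_same]
  · rw [apply_matrixUnit_of_ne e h, if_neg h, Matrix.trace_zero]

theorem exists_iso_simpleRep_directSum (X : FinRep k H) [Nontrivial X.V] :
    ∃ i, ∃ X' : FinRep k H, FinRep.Iso ((simpleRep e i).directSum X') X := by
  obtain ⟨x, hx⟩ := exists_ne (0 : X.V)
  obtain ⟨i, a, hia⟩ : ∃ i, ∃ a, X.ρ (matrixUnit e i a a) x ≠ 0 := by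
    by_contra! h
    apply hx
    have : X.ρ 1 x = x := by rw [map_one]; rfl
    rw [← this, ← sum_matrixUnit e]
    simp [map_sum, LinearMap.sum_apply, h]
  -- The vector w, nonzero and fixed by E_00, generates a copy of the i-th simple module via v ↦ Σ
  -- v_b E_b0 w. A form φ with φ(w) = 1 gives the equivariant retraction x ↦ (φ(E_0b x))_b, which
  -- splits this copy off.
  set w := X.ρ (matrixUnit e i 0 a) x with hw
  have hw₀ : w ≠ 0 := by
    intro h
    apply hia
    have : matrixUnit e i a a = matrixUnit e i a 0 * matrixUnit e i 0 a := by
      rw [matrixUnit_mul_matrixUnit, if_pos rfl]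
    rw [this, map_mul, Module.End.mul_apply, ← hw, h, map_zero]
  have hw₁ : X.ρ (matrixUnit e i 0 0) w = w := by
    rw [hw, ← Module.End.mul_apply, ← map_mul, matrixUnit_mul_matrixUnit, if_pos rfl]
  obtain ⟨φ, hφ⟩ : ∃ φ : Module.Dual k X.V, φ w = 1 := by
    obtain ⟨φ, hφ⟩ : ∃ φ : Module.Dual k X.V, φ w ≠ 0 := by
      by_contra! h
      exact hw₀ ((Module.forall_dual_apply_eq_zero_iff k w).1 h)
    exact ⟨(φ w)⁻¹ • φ, by simp [hφ]⟩
  let ι : (Fin (d i) → k) →ₗ[k] X.V :=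
    ∑ b, (LinearMap.proj b).smulRight (X.ρ (matrixUnit e i b 0) w)
  have hι : ∀ v, ι v = ∑ b, v b • X.ρ (matrixUnit e i b 0) w := by
    intro v
    simp [ι]
  let π : X.V →ₗ[k] (Fin (d i) → k) := LinearMap.pi fun b => φ ∘ₗ X.ρ (matrixUnit e i 0 b)
  have hπ : ∀ x b, π x b = φ (X.ρ (matrixUnit e i 0 b) x) := fun x b => rfl
  have h₁ : ∀ h v, ι ((e h i).mulVec v) = X.ρ h (ι v) := by
    intro h v
    rw [hι, hι]
    simp only [map_sum, map_smul, ← Module.End.mul_apply, ← map_mul, mul_matrixUnit,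
      Matrix.mulVec, dotProduct, Finset.sum_smul, LinearMap.sum_apply, LinearMap.smul_apply,
      Finset.smul_sum, smul_smul]
    rw [Finset.sum_comm]
    simp only [mul_comm]
  have h₂ : ∀ h x, π (X.ρ h x) = (e h i).mulVec (π x) := by
    intro h x
    funext b
    rw [hπ, ← Module.End.mul_apply, ← map_mul, matrixUnit_mul]
    simp [Matrix.mulVec, dotProduct, hπ]
  have h₃ : ∀ v, π (ι v) = v := by
    intro v
    funext b
    rw [hι, hπ]
    simp only [map_sum, map_smul, ← Module.End.mul_apply, ← map_mul, matrixUnit_mul_matrixUnit]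
    rw [Finset.sum_eq_single b]
    · simp [hw₁, hφ]
    · intro c _ hc
      simp [hc.symm]
    · simp
  exact ⟨i, _, FinRep.iso_directSum_ker (Y := simpleRep e i) ι π h₁ h₂ h₃⟩

theorem of_mem_closure_simpleRep (X : FinRep k H) :
    RepRing.of X ∈ AddSubgroup.closure (Set.range fun i => RepRing.of (simpleRep e i)) := by
  induction hm : Module.finrank k X.V using Nat.strong_induction_on generalizing X with
  | _ m ih =>
    cases subsingleton_or_nontrivial X.V with
    | inl h => rw [RepRing.of_eq_zero]; exact zero_mem _
    | inr h =>
      obtain ⟨i, X', hX'⟩ := exists_iso_simpleRep_directSum e X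
      rw [← RepRing.of_iso hX', RepRing.of_directSum]
      refine add_mem (AddSubgroup.subset_closure ⟨i, rfl⟩) (ih _ ?_ X' rfl)
      obtain ⟨f, -⟩ := hX'
      have h₁ := f.finrank_eq
      have h₂ : Module.finrank k ((simpleRep e i).directSum X').V =
          d i + Module.finrank k X'.V := by
        change Module.finrank k ((Fin (d i) → k) × X'.V) = _
        rw [Module.finrank_prod, Module.finrank_fin_fun]
      have := NeZero.pos (d i)
      omega

theorem span_simpleRep :
    Submodule.span k (Set.range fun i => (1 : k) ⊗ₜ[ℤ] RepRing.of (simpleRep e i)) =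
      (⊤ : Submodule k (RepAlgebra k H)) := by
  have : AddSubgroup.closure (Set.range fun i => RepRing.of (simpleRep e i)) = ⊤ := by
    rw [eq_top_iff, ← RepRing.closure_range_of, AddSubgroup.closure_le]
    rintro _ ⟨X, rfl⟩
    exact of_mem_closure_simpleRep e X
  rw [← RepAlgebra.span_eq_top this, ← Set.range_comp]
  rfl

include e in
-- The classes of the simple modules span R_k(H), and the matrix units E_00 separate their
-- characters.
theorem characterMap_injective_of_algEquiv : Function.Injective (characterMap k H) := by
  refine (injective_iff_map_eq_zero _).2 fun x hx => ?_
  have hmem : x ∈ Submodule.span k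
      (Set.range fun i => (1 : k) ⊗ₜ[ℤ] RepRing.of (simpleRep e i)) :=
    span_simpleRep e ▸ Submodule.mem_top
  obtain ⟨c, rfl⟩ := (Submodule.mem_span_range_iff_exists_fun k).1 hmem
  simp only [map_sum, map_smul, characterMap_of] at hx
  refine Finset.sum_eq_zero fun j _ => ?_
  have := LinearMap.congr_fun hx (matrixUnit e j 0 0)
  simp only [LinearMap.sum_apply, LinearMap.smul_apply, simpleRep_character_matrixUnit] at this
  have hj : c j = 0 := by simpa using this
  rw [hj, zero_smul]

variable (k H) in
theorem characterMap_injective [IsAlgClosed k] [IsSemisimpleRing H] [Module.Finite k H] :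
    Function.Injective (characterMap k H) := by
  obtain ⟨n, d, hd, ⟨e⟩⟩ := IsSemisimpleRing.exists_algEquiv_pi_matrix_of_isAlgClosed k H
  exact characterMap_injective_of_algEquiv e

theorem exists_characterMap_eq [IsAlgClosed k] [IsSemisimpleRing H] [Module.Finite k H]
    {f : Module.Dual k H} (hf : ∀ a b, f (a * b) = f (b * a)) :
    ∃ x, characterMap k H x = f := by
  obtain ⟨n, d, hd, ⟨e⟩⟩ := IsSemisimpleRing.exists_algEquiv_pi_matrix_of_isAlgClosed k H
  refine ⟨∑ i, f (matrixUnit e i 0 0) • ((1 : k) ⊗ₜ[ℤ] RepRing.of (simpleRep e i)), ?_⟩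
  simp only [map_sum, map_smul, characterMap_of]
  exact (eq_sum_character e hf).symm

end Wedderburn

/-! ### The embedding of the representation algebra and its image -/

section Main

variable {k : Type u} [Field k] {H : Type v} [Ring H] [HopfAlgebra k H] {R : H ⊗[k] H}

theorem characterMap_one : characterMap k H 1 = counit (R := k) := by
  rw [Algebra.TensorProduct.one_def, ← RepRing.of_trivial, characterMap_of,
    FinRep.character_trivial]

theorem RepAlgebra.mem_span_of (x : RepAlgebra k H) :
    x ∈ Submodule.span k (Set.range fun X : FinRep k H => (1 : k) ⊗ₜ[ℤ] RepRing.of X) := by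
  rw [RepAlgebra.span_of]
  exact Submodule.mem_top

theorem characterMap_mem (x : RepAlgebra k H) : characterMap k H x ∈ classFunctions k H := by
  have hx := RepAlgebra.mem_span_of x
  induction hx using Submodule.span_induction with
  | mem x hx =>
    obtain ⟨X, rfl⟩ := hx
    rw [characterMap_of]
    exact X.character_mem
  | zero => rw [map_zero]; exact zero_mem _
  | add x y _ _ hx hy => rw [map_add]; exact add_mem hx hy
  | smul c x _ hx => rw [map_smul]; exact Submodule.smul_mem _ _ hx

theorem characterMap_mul (x y : RepAlgebra k H) :
    characterMap k H (x * y) = dualConv (characterMap k H x) (characterMap k H y) := by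
  have hx := RepAlgebra.mem_span_of x
  have hy := RepAlgebra.mem_span_of y
  induction hx using Submodule.span_induction with
  | zero => rw [zero_mul, map_zero]; rfl
  | add x x' _ _ hx hx' => rw [add_mul, map_add, map_add, hx, hx']; rfl
  | smul c x _ hx => rw [smul_mul_assoc, map_smul, map_smul, hx]; rfl
  | mem x hx =>
    obtain ⟨X, rfl⟩ := hx
    induction hy using Submodule.span_induction with
    | zero => ext h; simp [dualConv, sliceRight]
    | add y y' _ _ hy hy' =>
      rw [mul_add, map_add, map_add, hy, hy']
      ext h
      simp [dualConv, sliceRight, LinearMap.lTensor_add]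
    | smul c y _ hy =>
      rw [mul_smul_comm, map_smul, map_smul, hy]
      ext h
      simp [dualConv, sliceRight_smul]
    | mem y hy =>
      obtain ⟨Y, rfl⟩ := hy
      rw [Algebra.TensorProduct.tmul_mul_tmul, one_mul, ← RepRing.of_tensor, characterMap_of,
        characterMap_of, characterMap_of, FinRep.character_tensor]

namespace IsFactorizable

variable [CharZero k] [IsSemisimpleRing H] (hR : IsFactorizable R)
include hR

theorem drinfeldMap_mem_center {f : Module.Dual k H} (hf : f ∈ classFunctions k H) :
    drinfeldMap R f ∈ Subalgebra.center k H := by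
  have := finite_of_drinfeldMap_surjective hR.bijective.2
  obtain ⟨lam, Lam, I, -⟩ := hR.exists_integralPair
  exact (Subalgebra.mem_center_iff (R := k)).2 fun b =>
    (hR.quasitriangular.drinfeldMap_mul_comm_of_trace I.antipode_sq hf b).symm

theorem drinfeldMap_dualConv {f g : Module.Dual k H} (hf : f ∈ classFunctions k H)
    (hg : g ∈ classFunctions k H) :
    drinfeldMap R (dualConv f g) = drinfeldMap R f * drinfeldMap R g := by
  have h : ∀ f ∈ classFunctions k H, ∀ b, b * drinfeldMap R f = drinfeldMap R f * b :=
    fun f hf => (Subalgebra.mem_center_iff (R := k)).1 (hR.drinfeldMap_mem_center hf)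
  rw [hR.quasitriangular.drinfeldMap_dualConv f g fun b => (h g hg b).symm, h f hf]

/-- Since 1 is central, 1 = Φ(f) for a class function f, and then Φ(ε) = Φ(f)Φ(ε) = Φ(f * ε) = Φ(f)
= 1. -/
theorem drinfeldMap_counit : drinfeldMap R (counit (R := k)) = 1 := by
  have hε : counit (R := k) ∈ classFunctions k H := fun a b => by
    rw [Bialgebra.counit_mul, Bialgebra.counit_mul, mul_comm]
  obtain ⟨f, hf, h₁⟩ := hR.exists_classFunction (z := 1) (one_mem _)
  have h₂ := hR.drinfeldMap_dualConv hf hε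
  have h₃ : dualConv f (counit (R := k)) = f := by
    ext h
    simp [dualConv, sliceRight_comul_counit]
  rw [h₃, h₁, one_mul] at h₂
  exact h₂.symm

/-- The algebra map `R_k(H) → H`, `1 ⊗ [X] ↦ Φ(χ_X)`. -/
def repAlgebraHom : RepAlgebra k H →ₐ[k] H :=
  AlgHom.ofLinearMap (drinfeldMap R ∘ₗ characterMap k H)
    (by rw [LinearMap.comp_apply, characterMap_one, hR.drinfeldMap_counit])
    (fun x y => by
      simp only [LinearMap.comp_apply]
      rw [characterMap_mul,
        hR.drinfeldMap_dualConv (characterMap_mem x) (characterMap_mem y)])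

theorem invariantsForm_eq :
    invariantsForm k H =
      normalizedRegularCharacter k H ∘ₗ (drinfeldMap R ∘ₗ characterMap k H) := by
  have := finite_of_drinfeldMap_surjective hR.bijective.2
  obtain ⟨lam, Lam, I, hL⟩ := hR.exists_integralPair
  rw [I.eq_normalizedRegularCharacter]
  refine LinearMap.ext_on_range RepAlgebra.span_of fun X => ?_
  rw [invariantsForm_of, LinearMap.comp_apply, LinearMap.comp_apply, characterMap_of,
    apply_drinfeldMap_comm I.map_mul_comm X.character_mem, hL,
    X.character_integral I.mul_left I.counit_eq_one]

theorem range_repAlgebraHom [IsAlgClosed k] :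
    hR.repAlgebraHom.range = Subalgebra.center k H := by
  have := finite_of_drinfeldMap_surjective hR.bijective.2
  refine le_antisymm ?_ fun z hz => ?_
  · rintro _ ⟨x, rfl⟩
    exact hR.drinfeldMap_mem_center (characterMap_mem x)
  · obtain ⟨f, hf, rfl⟩ := hR.exists_classFunction hz
    obtain ⟨x, rfl⟩ := exists_characterMap_eq hf
    exact ⟨x, rfl⟩

theorem repAlgebraHom_injective [IsAlgClosed k] : Function.Injective hR.repAlgebraHom := by
  have := finite_of_drinfeldMap_surjective hR.bijective.2
  exact hR.bijective.1.comp (characterMap_injective k H)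

theorem isSymmetricEmbedding [IsAlgClosed k] :
    IsSymmetricEmbedding (A := RepAlgebra k H) (invariantsForm k H)
      (normalizedRegularCharacter k H) hR.repAlgebraHom := by
  have := finite_of_drinfeldMap_surjective hR.bijective.2
  obtain ⟨lam, Lam, I, hL⟩ := hR.exists_integralPair
  have hδ : ∀ x, invariantsForm k H x = lam (hR.repAlgebraHom x) := fun x => by
    rw [hR.invariantsForm_eq, I.eq_normalizedRegularCharacter]
    rfl
  have hc : ∀ x, hR.repAlgebraHom x ∈ Subalgebra.center k H := fun x =>
    hR.range_repAlgebraHom ▸ hR.repAlgebraHom.mem_range_self x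
  refine ⟨⟨?_, ?_, ?_⟩, ⟨this, ?_, ?_⟩, hR.invariantsForm_eq, hR.repAlgebraHom_injective⟩
  · exact Module.Finite.of_injective hR.repAlgebraHom.toLinearMap hR.repAlgebraHom_injective
  · intro a b
    rw [hδ, hδ, map_mul hR.repAlgebraHom, map_mul hR.repAlgebraHom, I.map_mul_comm]
  · intro a ha
    apply hR.repAlgebraHom_injective
    rw [map_zero]
    -- The image of Ψ is the whole center, so vanishing of δ(xa) for all x says that Ψ(a) is
    -- orthogonal to the center under lam.
    refine I.eq_zero_of_forall_center (hc a) fun c hc => ?_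
    rw [← hR.range_repAlgebraHom] at hc
    obtain ⟨x, rfl⟩ := hc
    rw [← ha x, hδ, map_mul hR.repAlgebraHom]
    rfl
  · rw [I.eq_normalizedRegularCharacter]
    exact I.map_mul_comm
  · rw [I.eq_normalizedRegularCharacter]
    exact fun a => I.eq_zero_of_forall

end IsFactorizable

end Main
end HopfRep

end

theorem propositionF {k : Type u} [Field k] [IsAlgClosed k] [CharZero k]
    {H : Type v} [Ring H] [HopfAlgebra k H] [IsSemisimpleRing H]
    (R : H ⊗[k] H) (hR : HopfRep.IsFactorizable R) :
    ∃ Ψ : HopfRep.RepAlgebra k H →ₐ[k] H,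
      Ψ.toLinearMap = HopfRep.drinfeldMap R ∘ₗ HopfRep.characterMap k H ∧
      HopfRep.IsSymmetricEmbedding (A := HopfRep.RepAlgebra k H) (HopfRep.invariantsForm k H)
        (HopfRep.normalizedRegularCharacter k H) Ψ ∧
      Ψ.range = Subalgebra.center k H :=
  ⟨hR.repAlgebraHom, rfl, hR.isSymmetricEmbedding, hR.range_repAlgebraHom⟩
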